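/- Let $X$ be a smooth $n$-dimensional manifold (Hausdorff, second countable, without boundary, $n\ge 0$), let $\mathcal{A}^{\mathrm{even}}(X)=\bigoplus_m\mathcal{A}^{2m}(X,\mathbb{C})$ and $\mathcal{A}^{\mathrm{odd}}(X)=\bigoplus_m\mathcal{A}^{2m+1}(X,\mathbb{C})$ be the spaces of smooth complex-valued differential forms of even and odd degree, and for a smooth complex vector bundle $V$ over $X$ with a connection $\nabla$ let $$\mathrm{ch}(V,\nabla)=\mathrm{Tr}\exp\Big(\frac{\sqrt{-1}}{2\pi}\nabla^2\Big)\in\mathcal{A}^{\mathrm{even}}(X),$$ where $\nabla^2$ is the curvature of $\nabla$. Let $\hat K_0(X)$ be the Grothendieck group of complex vector bundles with connection over $X$, the connections being taken up to Chern–Simons equivalence ($\nabla^0\sim\nabla^1$ if the Chern–Simons form of the pair is exact), and let $\mathrm{ch}:\hat K_0(X)\to\mathcal{A}^{\mathrm{even}}(X)$ be the homomorphism with $[V,\nabla]\mapsto\mathrm{ch}(V,\nabla)$; its image is the additive subgroup of $\mathcal{A}^{\mathrm{even}}(X)$ generated by the forms $\mathrm{ch}(V,\nabla)$. Then the image of $\mathrm{ch}:\hat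 K_0(X)\to\mathcal{A}^{\mathrm{even}}(X)$ contains all exact even forms. Specifically, for every exact even form $\omega$ (that is, $\omega=d\alpha$ with $\alpha\in\mathcal{A}^{\mathrm{odd}}(X)$, not necessarily homogeneous) there are an integer $r\ge 0$ and an $r\times r$ matrix $A$ of smooth complex $1$-forms on $X$ such that, for the trivial vector bundle $V=X\times\mathbb{C}^r$ with the connection $\nabla=d+A$ and with the trivial connection $d$, $$\mathrm{ch}(V,\nabla)-\mathrm{ch}(V,d)=\omega.$$ -/

import Mathlib

open scoped Manifold ContDiff

noncomputable section

namespace ChernForms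

/-! ### Complex differential forms on a smooth `n`-dimensional manifold -/

/-- Exterior product of complex-valued alternating forms, with the normalisation
`(a ∧ b)(v) = 1 / (p! q!) * ∑ σ, sign σ * a (v_σ(1), …, v_σ(p)) * b (v_σ(p+1), …, v_σ(p+q))`,
so that `(a ∧ b)(v, w) = a v * b w - a w * b v` for `p = q = 1`. -/
def wedgeAlt {W : Type*} [AddCommGroup W] [Module ℝ W] [TopologicalSpace W] {p q : ℕ}
    (a : W [⋀^Fin p]→L[ℝ] ℂ) (b : W [⋀^Fin q]→L[ℝ] ℂ) : W [⋀^Fin (p + q)]→L[ℝ] ℂ :=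
  ((p.factorial : ℂ) * (q.factorial : ℂ))⁻¹ •
    ContinuousMultilinearMap.alternatization
      { toFun := fun v : Fin (p + q) → W =>
          a (fun i => v (Fin.castAdd q i)) * b (fun j => v (Fin.natAdd p j))
        map_update_add' := by
          intro _ v i x y
          rcases Nat.lt_or_ge i.1 p with hi | hi
          · obtain ⟨i, rfl⟩ : ∃ i' : Fin p, i = Fin.castAdd q i' := ⟨⟨i.1, hi⟩, rfl⟩
            have h1 (z : W) : (fun k => Function.update v (Fin.castAdd q i) z (Fin.castAdd q k))
                = Function.update (fun k => v (Fin.castAdd q k)) i z := by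
              ext k; simp [Function.update_apply, Fin.ext_iff]
            have h2 (z : W) : (fun k => Function.update v (Fin.castAdd q i) z (Fin.natAdd p k))
                = fun k => v (Fin.natAdd p k) := by
              ext k
              have : p + k.1 ≠ i.1 := by omega
              simp [Fin.ext_iff, this]
            simp only [h1, h2, a.map_update_add, add_mul]
          · obtain ⟨i, rfl⟩ : ∃ i' : Fin q, i = Fin.natAdd p i' :=
              ⟨⟨i.1 - p, by omega⟩, by ext; simp; omega⟩
            have h1 (z : W) : (fun k => Function.update v (Fin.natAdd p i) z (Fin.castAdd q k))
                = fun k => v (Fin.castAdd q k) := by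
              ext k
              have : k.1 ≠ p + i.1 := by omega
              simp [Fin.ext_iff, this]
            have h2 (z : W) : (fun k => Function.update v (Fin.natAdd p i) z (Fin.natAdd p k))
                = Function.update (fun k => v (Fin.natAdd p k)) i z := by
              ext k; simp [Function.update_apply, Fin.ext_iff]
            simp only [h1, h2, b.map_update_add, mul_add]
        map_update_smul' := by
          intro _ v i c x
          rcases Nat.lt_or_ge i.1 p with hi | hi
          · obtain ⟨i, rfl⟩ : ∃ i' : Fin p, i = Fin.castAdd q i' := ⟨⟨i.1, hi⟩, rfl⟩
            have h1 (z : W) : (fun k => Function.update v (Fin.castAdd q i) z (Fin.castAdd q k))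
                = Function.update (fun k => v (Fin.castAdd q k)) i z := by
              ext k; simp [Function.update_apply, Fin.ext_iff]
            have h2 (z : W) : (fun k => Function.update v (Fin.castAdd q i) z (Fin.natAdd p k))
                = fun k => v (Fin.natAdd p k) := by
              ext k
              have : p + k.1 ≠ i.1 := by omega
              simp [Fin.ext_iff, this]
            simp only [h1, h2, a.map_update_smul, smul_mul_assoc]
          · obtain ⟨i, rfl⟩ : ∃ i' : Fin q, i = Fin.natAdd p i' :=
              ⟨⟨i.1 - p, by omega⟩, by ext; simp; omega⟩
            have h1 (z : W) : (fun k => Function.update v (Fin.natAdd p i) z (Fin.castAdd q k))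
                = fun k => v (Fin.castAdd q k) := by
              ext k
              have : k.1 ≠ p + i.1 := by omega
              simp [Fin.ext_iff, this]
            have h2 (z : W) : (fun k => Function.update v (Fin.natAdd p i) z (Fin.natAdd p k))
                = Function.update (fun k => v (Fin.natAdd p k)) i z := by
              ext k; simp [Function.update_apply, Fin.ext_iff]
            simp only [h1, h2, b.map_update_smul, mul_smul_comm]
        cont := by
          exact (a.coe_continuous.comp (by fun_prop)).mul (b.coe_continuous.comp (by fun_prop)) }

section Forms

variable (n : ℕ) (X : Type*) [TopologicalSpace X] [ChartedSpace (EuclideanSpace ℝ (Fin n)) X]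

/-- Complex-valued `k`-forms on `X` (sections of `Λᵏ T*X ⊗ ℂ`; smoothness is `IsSmoothOn`). -/
abbrev DiffForm (k : ℕ) : Type _ :=
  (x : X) → (TangentSpace (𝓡 n) x) [⋀^Fin k]→L[ℝ] ℂ

/-- Inhomogeneous forms of even degree; the component at `m` has degree `2 m`. -/
abbrev EvenForm : Type _ := (m : ℕ) → DiffForm n X (2 * m)

/-- Inhomogeneous forms of odd degree; the component at `m` has degree `2 m + 1`. -/
abbrev OddForm : Type _ := (m : ℕ) → DiffForm n X (2 * m + 1)

end Forms

variable {n : ℕ} {X : Type*} [TopologicalSpace X] [ChartedSpace (EuclideanSpace ℝ (Fin n)) X]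

/-- A complex function as a `0`-form. -/
def ofFun (f : X → ℂ) : DiffForm n X 0 := fun x =>
  ContinuousAlternatingMap.constOfIsEmpty ℝ (TangentSpace (𝓡 n) x) (Fin 0) (f x)

/-- The exterior product of forms. -/
def wedge {p q : ℕ} (a : DiffForm n X p) (b : DiffForm n X q) : DiffForm n X (p + q) :=
  fun x => wedgeAlt (a x) (b x)

/-- The expression of a form in the preferred chart at `x₀`: its pullback under the inverse of the
chart (meaningful on the target of the chart). -/
def inChart {k : ℕ} (x₀ : X) (a : DiffForm n X k) (y : EuclideanSpace ℝ (Fin n)) :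
    (EuclideanSpace ℝ (Fin n)) [⋀^Fin k]→L[ℝ] ℂ :=
  (a ((extChartAt (𝓡 n) x₀).symm y)).compContinuousLinearMap
    (mfderiv 𝓘(ℝ, EuclideanSpace ℝ (Fin n)) (𝓡 n) (extChartAt (𝓡 n) x₀).symm y)

/-- A form is smooth on the (open) set `U` if all its chart expressions are. -/
def IsSmoothOn {k : ℕ} (a : DiffForm n X k) (U : Set X) : Prop :=
  ∀ x₀ : X, ContDiffOn ℝ ∞ (inChart x₀ a)
    ((extChartAt (𝓡 n) x₀).target ∩ (extChartAt (𝓡 n) x₀).symm ⁻¹' U)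

/-- A form is smooth if all its chart expressions are. -/
def IsSmooth {k : ℕ} (a : DiffForm n X k) : Prop := IsSmoothOn a Set.univ

/-- The exterior derivative, computed at `x` in the preferred chart at `x` and pulled back. -/
def extD {k : ℕ} (a : DiffForm n X k) : DiffForm n X (k + 1) := fun x =>
  (extDeriv (inChart x a) (extChartAt (𝓡 n) x x)).compContinuousLinearMap
    (mfderiv (𝓡 n) 𝓘(ℝ, EuclideanSpace ℝ (Fin n)) (extChartAt (𝓡 n) x) x)

/-- The exterior derivative of an inhomogeneous odd form, an inhomogeneous even form. -/
def extDOdd (a : OddForm n X) : EvenForm n X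
  | 0 => 0
  | m + 1 => extD (a m)

/-- An even form is exact if it is the exterior derivative of a smooth odd form. -/
def IsExactEven (w : EvenForm n X) : Prop :=
  ∃ a : OddForm n X, (∀ m, IsSmooth (a m)) ∧ w = extDOdd a

/-! ### Matrices of forms, curvature and Chern character -/

/-- The product of matrices of forms, entries being multiplied by the exterior product. -/
def matWedge {p q : ℕ} {I J K : Type*} [Fintype J] (a : Matrix I J (DiffForm n X p))
    (b : Matrix J K (DiffForm n X q)) : Matrix I K (DiffForm n X (p + q)) :=
  fun i k => ∑ j, wedge (a i j) (b j k)

/-- The entrywise exterior derivative. -/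
def matD {p : ℕ} {I J : Type*} (a : Matrix I J (DiffForm n X p)) :
    Matrix I J (DiffForm n X (p + 1)) :=
  fun i j => extD (a i j)

/-- The matrix of `0`-forms given by a matrix-valued function. -/
def matOfFun {I J : Type*} (g : X → Matrix I J ℂ) : Matrix I J (DiffForm n X 0) :=
  fun i j => ofFun fun x => g x i j

/-- The curvature matrix `dA + A ∧ A` of the connection `d + A`. -/
def curvature {r : ℕ} (A : Matrix (Fin r) (Fin r) (DiffForm n X 1)) :
    Matrix (Fin r) (Fin r) (DiffForm n X 2) :=
  matD A + matWedge A A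

/-- The powers `F ^ m` of a matrix of `2`-forms. -/
def matPow {r : ℕ} (F : Matrix (Fin r) (Fin r) (DiffForm n X 2)) :
    (m : ℕ) → Matrix (Fin r) (Fin r) (DiffForm n X (2 * m))
  | 0 => matOfFun fun _ => 1
  | m + 1 => matWedge (matPow F m) F

/-- `Tr exp ((i / 2π) F)` for a matrix `F` of `2`-forms; the component of degree `2 m` is
`(1 / m!) (i / 2π) ^ m Tr (F ^ m)`. -/
def trExp {r : ℕ} (F : Matrix (Fin r) (Fin r) (DiffForm n X 2)) : EvenForm n X := fun m =>
  ((m.factorial : ℂ)⁻¹ * (Complex.I / (2 * Real.pi)) ^ m) • (matPow F m).trace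

variable (n X) in
/-- A smooth complex vector bundle on `X` with a connection, given by local frames: every `p : X`
has an open neighbourhood `U p` with a frame over it, the frames are related by
smooth transition matrices `g p q` on `U p ∩ U q` (frame coordinates transform as
`s_p = g_pq s_q`), and the connection is `d + A p` in the frame over `U p`.
The rank may vary from component to component. -/
structure BundleWithConnection where
  /-- the neighbourhoods carrying frames -/
  U : X → Set X
  isOpen_U : ∀ p, IsOpen (U p)
  mem_U : ∀ p, p ∈ U p
  /-- the rank over `U p` -/
  rank : X → ℕ
  /-- the transition matrices -/
  g : (p q : X) → X → Matrix (Fin (rank p)) (Fin (rank q)) ℂ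
  smooth_g : ∀ p q i j,
    ContMDiffOn (𝓡 n) 𝓘(ℝ, ℂ) ∞ (fun x => g p q x i j) (U p ∩ U q)
  g_self : ∀ p, ∀ x ∈ U p, g p p x = 1
  g_mul : ∀ p q s, ∀ x ∈ U p ∩ U q ∩ U s, g p q x * g q s x = g p s x
  /-- the connection matrices -/
  A : (p : X) → Matrix (Fin (rank p)) (Fin (rank p)) (DiffForm n X 1)
  smooth_A : ∀ p i j, IsSmoothOn (A p i j) (U p)
  A_change : ∀ p q, ∀ x ∈ U p ∩ U q, ∀ i j,
    A q i j x = ∑ k, ∑ l, (g q p x i k * g p q x l j) • A p k l x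
      + ∑ k, g q p x i k • extD (ofFun fun y => g p q y k j) x

/-- The Chern character form `ch (V, ∇) = Tr exp ((i / 2π) ∇²)`; near `x` it is computed in the
frame over `U x`, in which `∇² = dA + A ∧ A`. -/
def BundleWithConnection.ch (V : BundleWithConnection n X) : EvenForm n X :=
  fun m x => trExp (curvature (V.A x)) m x

/-- The Chern character on formal integral combinations of bundles with connection, additive and
equal to `ch (V, ∇)` on `(V, ∇)`. The differential `K`-group is a quotient of this free abelian
group on which the Chern character is induced by this map, so that the two have the same image. -/
def chHom : FreeAbelianGroup (BundleWithConnection n X) →+ EvenForm n X :=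
  FreeAbelianGroup.lift BundleWithConnection.ch

theorem inChart_ofFun_const (x₀ : X) (c : ℂ) :
    inChart x₀ (ofFun (n := n) fun _ : X => c) = fun _ =>
      ContinuousAlternatingMap.constOfIsEmpty ℝ (EuclideanSpace ℝ (Fin n)) (Fin 0) c := by
  rfl

theorem extD_ofFun_const (c : ℂ) : extD (ofFun (n := n) fun _ : X => c) = 0 := by
  funext x
  rw [extD, inChart_ofFun_const, extDeriv_constOfIsEmpty]
  have h : fderiv ℝ (fun _ : EuclideanSpace ℝ (Fin n) => c) (extChartAt (𝓡 n) x x) = 0 := by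
    simp
  rw [h]
  rfl

variable (X) in
/-- The trivial bundle `X × ℂ ^ r` with the connection `d + A`. -/
def trivialBundle (r : ℕ) (A : Matrix (Fin r) (Fin r) (DiffForm n X 1))
    (hA : ∀ i j, IsSmooth (A i j)) : BundleWithConnection n X where
  U _ := Set.univ
  isOpen_U _ := isOpen_univ
  mem_U _ := Set.mem_univ _
  rank _ := r
  g _ _ _ := 1
  smooth_g _ _ _ _ := contMDiffOn_const
  g_self _ _ _ := rfl
  g_mul _ _ _ _ _ := one_mul 1
  A _ := A
  smooth_A _ := hA
  A_change _ _ x _ i j := by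
    have h : ∀ k l : Fin r, ((1 : Matrix (Fin r) (Fin r) ℂ) i k
        * (1 : Matrix (Fin r) (Fin r) ℂ) l j) • A k l x
          = if l = j then if i = k then A k l x else 0 else 0 := by
      intro k l
      rw [Matrix.one_apply, Matrix.one_apply]
      split_ifs
      · rw [one_mul]; exact one_smul ℂ (A k l x)
      · rw [mul_zero]; exact zero_smul ℂ (A k l x)
      · rw [zero_mul]; exact zero_smul ℂ (A k l x)
      · rw [mul_zero]; exact zero_smul ℂ (A k l x)
    have h' : ∀ k : Fin r, (1 : Matrix (Fin r) (Fin r) ℂ) i k •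
        extD (ofFun (n := n) fun _ : X => (1 : Matrix (Fin r) (Fin r) ℂ) k j) x = 0 := by
      intro k
      rw [extD_ofFun_const]
      exact smul_zero (A := TangentSpace (𝓡 n) x [⋀^Fin 1]→L[ℝ] ℂ)
        ((1 : Matrix (Fin r) (Fin r) ℂ) i k)
    simp only [h, h', Finset.sum_const_zero, add_zero, Finset.sum_ite_eq, Finset.sum_ite_eq',
      Finset.mem_univ, if_true]

theorem isSmooth_zero {k : ℕ} : IsSmooth (0 : DiffForm n X k) := by
  intro x₀
  have : inChart x₀ (0 : DiffForm n X k) = fun _ => 0 := by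
    rfl
  rw [this]
  exact contDiffOn_const

end ChernForms

end

open scoped Manifold ContDiff

noncomputable section

/-! A connection `d + A` on a trivial bundle with `A` diagonal is a direct sum of line bundles `d +
a`. Since `a ∧ a = 0`, the curvature of `d + a` is `da`, and the degree `2m` part of its Chern
character is `(i/2π)^m (da)^m / m!`. Direct sums add Chern characters, so it suffices to write an
exact even form as a finite sum of differences `ch(d + a) - ch(d)` on the trivial line bundle.

An immersion of `X` in a Euclidean space makes every smooth form a finite sum of monomials `φ dg_1 ∧
… ∧ dg_p` with globally defined functions (`exists_eq_sum_monForm`). Hence exact forms of degree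
`2k` are sums of products `dψ_0 ∧ … ∧ dψ_(2k-1)`, and one such product has to be produced with
nothing in other degrees.

Take `a = c ∑ ψ_(2i) dψ_(2i+1)`, so that `da = cθ` with `θ = ∑ dψ_(2i) ∧ dψ_(2i+1)`, a sum of `k`
decomposable 2-forms. These commute and square to zero, so `θ^k` is `k!` times the wanted product
and `θ^m = 0` for `m > k`. Letting `c` run over `s z^j`, with `z` a primitive `k`-th root of unity,
kills the degrees `0 < m < k`; the constants in degree 0 cancel against `ch(d)`; and `s` is chosen
to normalise degree `2k` (`single_mem_closure`). -/

namespace ChernForms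

section

/-! ### Products of linear forms and powers of 2-forms -/

section Algebra

variable {W W' : Type*} [AddCommGroup W] [Module ℝ W] [TopologicalSpace W]
  [AddCommGroup W'] [Module ℝ W'] [TopologicalSpace W']

/-- The exterior product `u 0 ∧ … ∧ u (p - 1)` of complex-valued linear forms. -/
def detForm {p : ℕ} (u : Fin p → W →L[ℝ] ℂ) : W [⋀^Fin p]→L[ℝ] ℂ :=
  ContinuousMultilinearMap.alternatization
    ((ContinuousMultilinearMap.mkPiAlgebra ℝ (Fin p) ℂ).compContinuousLinearMap u)

theorem detForm_apply {p : ℕ} (u : Fin p → W →L[ℝ] ℂ) (v : Fin p → W) :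
    detForm u v = Matrix.det (Matrix.of fun i j => u i (v j)) := by
  rw [← Matrix.det_transpose, Matrix.det_apply, detForm,
    ContinuousMultilinearMap.alternatization_apply_apply]
  rfl

theorem detForm_apply_sum {p : ℕ} (u : Fin p → W →L[ℝ] ℂ) (v : Fin p → W) :
    detForm u v = ∑ σ : Equiv.Perm (Fin p), Equiv.Perm.sign σ • ∏ i, u i (v (σ i)) := by
  rw [detForm, ContinuousMultilinearMap.alternatization_apply_apply]
  rfl

theorem detForm_compContinuousLinearMap {p : ℕ} (u : Fin p → W →L[ℝ] ℂ) (L : W' →L[ℝ] W) :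
    (detForm u).compContinuousLinearMap L = detForm fun i => (u i).comp L := by
  ext v
  simp [detForm_apply]

theorem wedgeAlt_apply {p q : ℕ} (a : W [⋀^Fin p]→L[ℝ] ℂ) (b : W [⋀^Fin q]→L[ℝ] ℂ)
    (v : Fin (p + q) → W) :
    wedgeAlt a b v = ((p.factorial : ℂ) * (q.factorial : ℂ))⁻¹ *
      ∑ σ : Equiv.Perm (Fin (p + q)), Equiv.Perm.sign σ •
        (a (fun i => v (σ (Fin.castAdd q i))) * b (fun j => v (σ (Fin.natAdd p j)))) := by
  rw [wedgeAlt, ContinuousAlternatingMap.smul_apply,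
    ContinuousMultilinearMap.alternatization_apply_apply]
  rfl

theorem wedgeAlt_sum_smul {ι : Type*} (s : Finset ι) {p q : ℕ} (c : ℂ)
    (a : ι → W [⋀^Fin p]→L[ℝ] ℂ) (b : W [⋀^Fin q]→L[ℝ] ℂ) :
    wedgeAlt (c • ∑ i ∈ s, a i) b = c • ∑ i ∈ s, wedgeAlt (a i) b := by
  ext v
  simp only [wedgeAlt_apply, ContinuousAlternatingMap.smul_apply,
    ContinuousAlternatingMap.sum_apply, smul_eq_mul, Finset.mul_sum, Finset.sum_mul,
    Finset.smul_sum]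
  rw [Finset.sum_comm]
  refine Finset.sum_congr rfl fun i _ => Finset.sum_congr rfl fun σ _ => ?_
  simp only [Units.smul_def, zsmul_eq_mul]
  ring

theorem wedgeAlt_smul_sum {ι : Type*} (s : Finset ι) {p q : ℕ} (c : ℂ)
    (a : W [⋀^Fin p]→L[ℝ] ℂ) (b : ι → W [⋀^Fin q]→L[ℝ] ℂ) :
    wedgeAlt a (c • ∑ i ∈ s, b i) = c • ∑ i ∈ s, wedgeAlt a (b i) := by
  ext v
  simp only [wedgeAlt_apply, ContinuousAlternatingMap.smul_apply,
    ContinuousAlternatingMap.sum_apply, smul_eq_mul, Finset.mul_sum,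
    Finset.smul_sum]
  rw [Finset.sum_comm]
  refine Finset.sum_congr rfl fun i _ => Finset.sum_congr rfl fun σ _ => ?_
  simp only [Units.smul_def, zsmul_eq_mul]
  ring

@[simp] theorem wedgeAlt_zero_left {p q : ℕ} (b : W [⋀^Fin q]→L[ℝ] ℂ) :
    wedgeAlt (0 : W [⋀^Fin p]→L[ℝ] ℂ) b = 0 := by
  ext v; simp [wedgeAlt_apply]

@[simp] theorem wedgeAlt_zero_right {p q : ℕ} (a : W [⋀^Fin p]→L[ℝ] ℂ) :
    wedgeAlt a (0 : W [⋀^Fin q]→L[ℝ] ℂ) = 0 := by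
  ext v; simp [wedgeAlt_apply]

/-- Swapping the two arguments reindexes the alternating sum into its own negative. -/
theorem wedgeAlt_self_one (a : W [⋀^Fin 1]→L[ℝ] ℂ) : wedgeAlt a a = 0 := by
  ext v
  rw [wedgeAlt_apply]
  have h : ∀ S : ℂ, S = -S → S = 0 := fun S hS => by linear_combination hS / 2
  refine mul_eq_zero_of_right _ ?_
  apply h
  conv_lhs => rw [← Equiv.sum_comp (Equiv.mulRight (Equiv.swap (0 : Fin (1 + 1)) 1))]
  rw [← Finset.sum_neg_distrib]
  refine Finset.sum_congr rfl fun σ _ => ?_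
  have h0 : ∀ i : Fin 1, Equiv.swap (0 : Fin (1 + 1)) 1 (Fin.castAdd 1 i) = Fin.natAdd 1 i := by
    decide
  have h1 : ∀ i : Fin 1, Equiv.swap (0 : Fin (1 + 1)) 1 (Fin.natAdd 1 i) = Fin.castAdd 1 i := by
    decide
  simp only [Equiv.coe_mulRight, Equiv.Perm.mul_apply, h0, h1, map_mul,
    Equiv.Perm.sign_swap (zero_ne_one (α := Fin (1 + 1)))]
  rw [mul_comm (a _)]
  simp

/-- Expand both determinants over `τ` and `τ'`. For each fixed pair, reindexing `σ` by the block
permutation of `τ` and `τ'` absorbs their signs and leaves the full determinant. The `p! q!` equal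
copies cancel the normalisation of the wedge product. -/
theorem wedgeAlt_detForm {p q : ℕ} (u : Fin p → W →L[ℝ] ℂ) (u' : Fin q → W →L[ℝ] ℂ) :
    wedgeAlt (detForm u) (detForm u') = detForm (Fin.append u u') := by
  ext v
  rw [wedgeAlt_apply]
  have key : ∀ (τ : Equiv.Perm (Fin p)) (τ' : Equiv.Perm (Fin q)),
      ∑ σ : Equiv.Perm (Fin (p + q)), Equiv.Perm.sign σ •
        ((Equiv.Perm.sign τ • ∏ i, u i (v (σ (Fin.castAdd q (τ i))))) *
          (Equiv.Perm.sign τ' • ∏ i, u' i (v (σ (Fin.natAdd p (τ' i)))))) =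
        detForm (Fin.append u u') v := by
    intro τ τ'
    rw [detForm_apply_sum, ← Equiv.sum_comp
      (Equiv.mulRight (finSumFinEquiv.permCongr (Equiv.Perm.sumCongr τ τ')))
      (fun σ => Equiv.Perm.sign σ • ∏ i, Fin.append u u' i (v (σ i)))]
    refine Finset.sum_congr rfl fun σ _ => ?_
    rw [Fin.prod_univ_add]
    simp [Equiv.permCongr_apply, Units.smul_def, Equiv.Perm.sign_permCongr,
      Equiv.Perm.sign_sumCongr]
    ring
  have h : ∀ σ : Equiv.Perm (Fin (p + q)), Equiv.Perm.sign σ •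
      ((detForm u fun i => v (σ (Fin.castAdd q i))) *
        (detForm u' fun i => v (σ (Fin.natAdd p i)))) =
      ∑ τ : Equiv.Perm (Fin p), ∑ τ' : Equiv.Perm (Fin q), Equiv.Perm.sign σ •
        ((Equiv.Perm.sign τ • ∏ i, u i (v (σ (Fin.castAdd q (τ i))))) *
          (Equiv.Perm.sign τ' • ∏ i, u' i (v (σ (Fin.natAdd p (τ' i)))))) := by
    intro σ
    rw [detForm_apply_sum, detForm_apply_sum, Finset.sum_mul_sum]
    simp only [Finset.smul_sum]
  simp only [h]
  rw [Finset.sum_comm]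
  have h' : ∀ τ : Equiv.Perm (Fin p), ∑ σ : Equiv.Perm (Fin (p + q)),
      ∑ τ' : Equiv.Perm (Fin q), Equiv.Perm.sign σ •
        ((Equiv.Perm.sign τ • ∏ i, u i (v (σ (Fin.castAdd q (τ i))))) *
          (Equiv.Perm.sign τ' • ∏ i, u' i (v (σ (Fin.natAdd p (τ' i)))))) =
      q.factorial * detForm (Fin.append u u') v := by
    intro τ
    rw [Finset.sum_comm]
    simp only [key]
    simp [Fintype.card_perm]
  simp only [h']
  have hp : (p.factorial : ℂ) ≠ 0 := by exact_mod_cast p.factorial_ne_zero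
  have hq : (q.factorial : ℂ) ≠ 0 := by exact_mod_cast q.factorial_ne_zero
  simp only [Finset.sum_const, Finset.card_univ, Fintype.card_perm, Fintype.card_fin, nsmul_eq_mul]
  field_simp

theorem detForm_eq_zero {p : ℕ} (u : Fin p → W →L[ℝ] ℂ) {i j : Fin p} (hij : i ≠ j)
    (h : u i = u j) : detForm u = 0 := by
  ext v
  rw [detForm_apply]
  exact Matrix.det_zero_of_row_eq hij (by ext; simp [h])

/-- The exterior powers of a `2`-form. -/
def altPow (θ : W [⋀^Fin 2]→L[ℝ] ℂ) : (m : ℕ) → W [⋀^Fin (2 * m)]→L[ℝ] ℂ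
  | 0 => ContinuousAlternatingMap.constOfIsEmpty ℝ W (Fin 0) 1
  | m + 1 => wedgeAlt (altPow θ m) θ

/-- The list `u (J 0) 0, u (J 0) 1, u (J 1) 0, …`. -/
def pairs {A : Type*} {k m : ℕ} (u : Fin k → Fin 2 → A) (J : Fin m → Fin k) (l : Fin (2 * m)) :
    A :=
  u (J ⟨l / 2, by omega⟩) ⟨l % 2, by omega⟩

theorem append_pairs {A : Type*} {k m : ℕ} (u : Fin k → Fin 2 → A) (J : Fin m → Fin k)
    (j : Fin k) : Fin.append (pairs u J) (u j) = pairs u (Fin.snoc (α := fun _ => Fin k) J j) := by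
  funext l
  refine Fin.addCases (fun l => ?_) (fun l => ?_) l
  · rw [Fin.append_left]
    have : l.1 / 2 < m := by omega
    simp [pairs, Fin.snoc, this]
  · rw [Fin.append_right]
    have h1 : (2 * m + l.1) / 2 = m := by omega
    have h2 : (2 * m + l.1) % 2 = l := by omega
    simp [pairs, Fin.snoc, h1, h2]

/-- The multinomial expansion, kept as a sum over all words `J` in the summands; appending a letter
to `J` is the inductive step. -/
theorem altPow_smul_sum {k : ℕ} (c : ℂ) (u : Fin k → Fin 2 → W →L[ℝ] ℂ) (m : ℕ) :
    altPow (c • ∑ i, detForm (u i)) m = c ^ m • ∑ J : Fin m → Fin k, detForm (pairs u J) := by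
  induction m with
  | zero =>
    ext v
    simp [altPow, detForm_apply]
  | succ m ih =>
    rw [altPow, ih, wedgeAlt_sum_smul]
    simp only [wedgeAlt_smul_sum, wedgeAlt_detForm, append_pairs]
    rw [← Finset.smul_sum, smul_smul, pow_succ,
      ← (Fin.snocEquiv fun _ : Fin (m + 1) => Fin k).sum_comp, Fintype.sum_prod_type,
      Finset.sum_comm]
    rfl

theorem detForm_pairs_eq_zero {k m : ℕ} (u : Fin k → Fin 2 → W →L[ℝ] ℂ) (J : Fin m → Fin k)
    (hJ : ¬ Function.Injective J) : detForm (pairs u J) = 0 := by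
  simp only [Function.Injective, not_forall] at hJ
  obtain ⟨a, b, hab, hne⟩ := hJ
  refine detForm_eq_zero (i := ⟨2 * a, by omega⟩) (j := ⟨2 * b, by omega⟩) _ ?_ ?_
  · simpa [Fin.ext_iff] using hne
  · simp [pairs, hab]

/-- 2-forms commute: permuting the blocks permutes the rows of the determinant by two copies of `σ`,
of total sign `sign σ ^ 2 = 1`. -/
theorem detForm_pairs_perm {k : ℕ} (u : Fin k → Fin 2 → W →L[ℝ] ℂ) (σ : Equiv.Perm (Fin k)) :
    detForm (pairs u σ) = detForm (pairs u id) := by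
  ext v
  rw [detForm_apply, detForm_apply]
  -- Index rows and columns by (block, position in block), in the order `b + 2 i` used by `pairs`.
  let e : Fin k × Fin 2 ≃ Fin (2 * k) := finProdFinEquiv.trans (finCongr (mul_comm k 2))
  have he (i : Fin k) (b : Fin 2) : (e (i, b)).1 = b + 2 * i := rfl
  have h1 : ∀ τ : Fin k → Fin k, ∀ x : Fin k × Fin 2, pairs u τ (e x) = u (τ x.1) x.2 := by
    rintro τ ⟨i, b⟩
    have h2 : (b + 2 * i.1) / 2 = i := by omega
    have h3 : (b + 2 * i.1) % 2 = b := by omega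
    simp only [pairs, he, h2, h3]
  rw [← Matrix.det_submatrix_equiv_self e, ← Matrix.det_submatrix_equiv_self e]
  have h4 := Matrix.det_permute (Equiv.prodCongrLeft fun _ : Fin 2 => σ)
    ((Matrix.of fun i j => (pairs u id i) (v j)).submatrix e e)
  rw [Equiv.Perm.sign_prodCongrLeft] at h4
  have h5 : ∏ _k : Fin 2, Equiv.Perm.sign σ = 1 := by
    rw [Fin.prod_univ_two, Int.units_mul_self]
  rw [h5] at h4
  simp only [Units.val_one, Int.cast_one, one_mul] at h4
  rw [← h4]
  congr 1
  ext x y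
  simp [h1]

/-- Pigeonhole: a word longer than `k` repeats a block, hence a linear factor. -/
theorem altPow_of_lt {k m : ℕ} (c : ℂ) (u : Fin k → Fin 2 → W →L[ℝ] ℂ) (h : k < m) :
    altPow (c • ∑ i, detForm (u i)) m = 0 := by
  rw [altPow_smul_sum, Finset.sum_eq_zero, smul_zero]
  intro J _
  refine detForm_pairs_eq_zero u J fun hJ => ?_
  have := Fintype.card_le_of_injective J hJ
  simp at this
  omega

/-- Only words without repetition survive; these are the `k!` permutations, and all of them give the
same product. -/
theorem altPow_self {k : ℕ} (c : ℂ) (u : Fin k → Fin 2 → W →L[ℝ] ℂ) :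
    altPow (c • ∑ i, detForm (u i)) k = (c ^ k * k.factorial) • detForm (pairs u id) := by
  classical
  rw [altPow_smul_sum, mul_smul]
  congr 1
  have h : ∑ J : Fin k → Fin k, detForm (pairs u J) =
      ∑ σ : Equiv.Perm (Fin k), detForm (pairs u σ) := by
    symm
    refine Finset.sum_of_injOn (fun σ : Equiv.Perm (Fin k) => (σ : Fin k → Fin k))
      (fun _ _ _ _ h => DFunLike.coe_injective h) (fun _ _ => Finset.mem_coe.2 (Finset.mem_univ _))
      ?_ (fun _ _ => rfl)
    intro J _ hJ
    refine detForm_pairs_eq_zero u J fun hi => hJ ?_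
    exact ⟨Equiv.ofBijective J (Finite.injective_iff_bijective.1 hi), by simp, rfl⟩
  rw [h]
  simp only [detForm_pairs_perm, Finset.sum_const, Finset.card_univ, Fintype.card_perm,
    Fintype.card_fin]
  ext v
  simp

end Algebra

end

section

/-! ### Monomial forms on a normed space -/

section Normed

variable {E : Type*} [NormedAddCommGroup E] [NormedSpace ℝ E]

/-- The bilinear form `v, w ↦ u v • a w`, before alternatization. -/
def smulForm {p : ℕ} (u : E →L[ℝ] ℂ) (a : E [⋀^Fin p]→L[ℝ] ℂ) : E →L[ℝ] E [⋀^Fin p]→L[ℝ] ℂ :=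
  ((ContinuousLinearMap.lsmul ℝ ℂ).flip a).comp u

/-- Laplace expansion of the determinant along its first row. -/
theorem alternatizeUncurryFin_smulForm {p : ℕ} (u : E →L[ℝ] ℂ) (w : Fin p → E →L[ℝ] ℂ) :
    ContinuousAlternatingMap.alternatizeUncurryFin (smulForm u (detForm w)) =
      detForm (Fin.cons (α := fun _ => E →L[ℝ] ℂ) u w) := by
  ext v
  rw [ContinuousAlternatingMap.alternatizeUncurryFin_apply, detForm_apply, Matrix.det_succ_row_zero]
  refine Finset.sum_congr rfl fun i _ => ?_
  simp only [smulForm, ContinuousLinearMap.comp_apply, ContinuousLinearMap.flip_apply,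
    ContinuousLinearMap.lsmul_apply, ContinuousAlternatingMap.smul_apply, detForm_apply]
  simp [mul_assoc, Matrix.submatrix, Fin.removeNth]

theorem contDiffOn_detForm {E' : Type*} [NormedAddCommGroup E'] [NormedSpace ℝ E'] {r : ℕ∞ω}
    {s : Set E'} {p : ℕ} {u : Fin p → E' → E →L[ℝ] ℂ} (hu : ∀ i, ContDiffOn ℝ r (u i) s) :
    ContDiffOn ℝ r (fun y => detForm fun i => u i y) s := by
  induction p with
  | zero =>
    have : (fun y => detForm fun i => u i y) = fun _ : E' => detForm (W := E) Fin.elim0 := by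
      funext y; congr 1; funext i; exact i.elim0
    rw [this]
    exact contDiffOn_const
  | succ p ih =>
    have : (fun y => detForm fun i => u i y) = fun y =>
        ContinuousAlternatingMap.alternatizeUncurryFinCLM ℝ E ℂ
          (smulForm (u 0 y) (detForm fun i : Fin p => u i.succ y)) := by
      funext y
      rw [ContinuousAlternatingMap.alternatizeUncurryFinCLM_apply, alternatizeUncurryFin_smulForm]
      congr 1
      funext i
      refine Fin.cases ?_ (fun i => ?_) i <;> simp
    rw [this]
    have h0 : ContDiff ℝ r fun b : E →L[ℝ] E [⋀^Fin p]→L[ℝ] ℂ =>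
        ContinuousAlternatingMap.alternatizeUncurryFinCLM ℝ E ℂ b := ContinuousLinearMap.contDiff _
    refine h0.comp_contDiffOn ?_
    have h : ContDiff ℝ r fun a : E [⋀^Fin p]→L[ℝ] ℂ => (ContinuousLinearMap.lsmul ℝ ℂ).flip a :=
      ContinuousLinearMap.contDiff _
    exact ContDiffOn.clm_comp (h.comp_contDiffOn (ih fun i => hu i.succ)) (hu 0)

/-- The form is the pullback under `F = (φ, g)` of `z_0 dz_1 ∧ … ∧ dz_p`. The latter has
coefficients linear in `z`, so its derivative is immediate, and `d` commutes with pullback; no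
second derivatives of `g` need to be cancelled by hand. -/
theorem extDeriv_smul_detForm {p : ℕ} {φ : E → ℂ} {g : Fin p → E → ℂ} {x : E}
    (hφ : ContDiffAt ℝ ∞ φ x) (hg : ∀ i, ContDiffAt ℝ ∞ (g i) x) :
    extDeriv (fun y => φ y • detForm fun i => fderiv ℝ (g i) y) x =
      detForm (Fin.cons (α := fun _ => E →L[ℝ] ℂ) (fderiv ℝ φ x) fun i => fderiv ℝ (g i) x) := by
  let F : E → Fin (p + 1) → ℂ := fun y i => Fin.cons (α := fun _ => E → ℂ) φ g i y
  have hF' : ∀ i, ContDiffAt ℝ ∞ (fun y => F y i) x := by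
    refine Fin.cases ?_ (fun i => ?_)
    · simpa [F] using hφ
    · simpa [F] using hg i
  have hF : ContDiffAt ℝ ∞ F x := contDiffAt_pi.2 hF'
  let P : Fin (p + 1) → (Fin (p + 1) → ℂ) →L[ℝ] ℂ := fun i =>
    ContinuousLinearMap.proj (R := ℝ) (φ := fun _ : Fin (p + 1) => ℂ) i
  let om : (Fin (p + 1) → ℂ) → (Fin (p + 1) → ℂ) [⋀^Fin p]→L[ℝ] ℂ := fun z =>
    z 0 • detForm fun i : Fin p => P i.succ
  have hom : ∀ z, HasFDerivAt om (smulForm (P 0) (detForm fun i : Fin p => P i.succ)) z :=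
    fun z => (smulForm (P 0) (detForm fun i : Fin p => P i.succ)).hasFDerivAt
  have hder : ∀ y, (∀ i, DifferentiableAt ℝ (fun y => F y i) y) →
      ∀ i, (P i).comp (fderiv ℝ F y) = fderiv ℝ (fun y => F y i) y := by
    intro y hy i
    exact (((P i).hasFDerivAt (x := F y)).comp y
      (differentiableAt_pi.2 hy).hasFDerivAt).fderiv.symm
  have hpb : extDeriv (fun y => (om (F y)).compContinuousLinearMap (fderiv ℝ F y)) x =
      (extDeriv om (F x)).compContinuousLinearMap (fderiv ℝ F x) :=
    extDeriv_pullback (hom _).differentiableAt hF (by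
      rw [minSmoothness_of_isRCLikeNormedField]; exact WithTop.coe_le_coe.2 le_top)
  have hev : (fun y => φ y • detForm fun i => fderiv ℝ (g i) y) =ᶠ[nhds x]
      fun y => (om (F y)).compContinuousLinearMap (fderiv ℝ F y) := by
    have h1 : ∀ᶠ y in nhds x, ∀ i, DifferentiableAt ℝ (fun y => F y i) y :=
      Filter.eventually_all.2 fun i => ((hF' i).of_le (m := 1) (by simp)).eventually (by simp)
        |>.mono fun y hy => hy.differentiableAt (by simp)
    filter_upwards [h1] with y hy
    have h2 : (om (F y)).compContinuousLinearMap (fderiv ℝ F y) =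
        F y 0 • (detForm fun i : Fin p => P i.succ).compContinuousLinearMap (fderiv ℝ F y) := rfl
    rw [h2, detForm_compContinuousLinearMap]
    simp only [hder y hy]
    simp [F]
  rw [hev.extDeriv_eq, hpb, extDeriv, (hom _).fderiv, alternatizeUncurryFin_smulForm,
    detForm_compContinuousLinearMap]
  congr 1
  funext i
  have h3 : ∀ i, DifferentiableAt ℝ (fun y => F y i) x := fun i => (hF' i).differentiableAt (by simp)
  refine Fin.cases ?_ (fun i => ?_) i
  · simpa [F] using hder x h3 0
  · simpa [F] using hder x h3 i.succ

theorem contDiffOn_alternating_apply {E' : Type*} [NormedAddCommGroup E'] [NormedSpace ℝ E']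
    {r : ℕ∞ω} {s : Set E'} {p : ℕ} {a : E' → E [⋀^Fin p]→L[ℝ] ℂ} {v : Fin p → E' → E}
    (ha : ContDiffOn ℝ r a s) (hv : ∀ i, ContDiffOn ℝ r (v i) s) :
    ContDiffOn ℝ r (fun y => a y fun i => v i y) s := by
  have h := (ContinuousLinearMap.analyticOnNhd_uncurry_of_multilinear (s := Set.univ)
    (ContinuousAlternatingMap.toContinuousMultilinearMapCLM (𝕜 := ℝ) (E := E) (F := ℂ)
      (ι := Fin p) ℝ)).contDiff (n := r)
  exact h.comp_contDiffOn (ha.prodMk (contDiffOn_pi.2 hv))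

end Normed

/-! ### Monomial forms on a manifold and their exterior derivatives -/

variable {n : ℕ} {X : Type*} [TopologicalSpace X] [ChartedSpace (EuclideanSpace ℝ (Fin n)) X]

/-- The differential of a vector-valued function. -/
def dFun {F : Type*} [NormedAddCommGroup F] [NormedSpace ℝ F] (g : X → F) (x : X) :
    TangentSpace (𝓡 n) x →L[ℝ] F :=
  mfderiv (𝓡 n) 𝓘(ℝ, F) g x

/-- The form `φ • dg 0 ∧ … ∧ dg (p - 1)`. -/
def monForm {p : ℕ} (φ : X → ℂ) (g : Fin p → X → ℂ) : DiffForm n X p := fun x =>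
  φ x • detForm fun i => dFun (g i) x

section Charts

variable [IsManifold (𝓡 n) ∞ X]

theorem isManifold_one : IsManifold (𝓡 n) 1 X := IsManifold.of_le (n := ∞) (by simp)

theorem mdifferentiableAt_symm {x₀ : X} {y : EuclideanSpace ℝ (Fin n)}
    (hy : y ∈ (extChartAt (𝓡 n) x₀).target) :
    MDifferentiableAt 𝓘(ℝ, EuclideanSpace ℝ (Fin n)) (𝓡 n) (extChartAt (𝓡 n) x₀).symm y := by
  have : IsManifold (𝓡 n) 1 X := isManifold_one
  have := mdifferentiableWithinAt_extChartAt_symm (I := 𝓡 n) hy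
  simpa [mdifferentiableWithinAt_univ] using this

theorem contDiffOn_comp_symm {F : Type*} [NormedAddCommGroup F] [NormedSpace ℝ F] {g : X → F}
    (hg : ContMDiff (𝓡 n) 𝓘(ℝ, F) ∞ g) (x₀ : X) :
    ContDiffOn ℝ ∞ (g ∘ (extChartAt (𝓡 n) x₀).symm) (extChartAt (𝓡 n) x₀).target :=
  (hg.comp_contMDiffOn (contMDiffOn_extChartAt_symm x₀)).contDiffOn

/-- The differential of the inverse of the preferred chart at `x₀`. -/
def dSymm (x₀ : X) (y : EuclideanSpace ℝ (Fin n)) :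
    EuclideanSpace ℝ (Fin n) →L[ℝ] TangentSpace (𝓡 n) ((extChartAt (𝓡 n) x₀).symm y) :=
  mfderiv 𝓘(ℝ, EuclideanSpace ℝ (Fin n)) (𝓡 n) (extChartAt (𝓡 n) x₀).symm y

theorem dFun_comp_dSymm {F : Type*} [NormedAddCommGroup F] [NormedSpace ℝ F] {g : X → F}
    (hg : ContMDiff (𝓡 n) 𝓘(ℝ, F) ∞ g) {x₀ : X} {y : EuclideanSpace ℝ (Fin n)}
    (hy : y ∈ (extChartAt (𝓡 n) x₀).target) :
    (dFun g ((extChartAt (𝓡 n) x₀).symm y)).comp (dSymm x₀ y) =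
    fderiv ℝ (g ∘ (extChartAt (𝓡 n) x₀).symm) y := by
  rw [← mfderiv_eq_fderiv]
  exact (mfderiv_comp y (hg.mdifferentiableAt (by simp)) (mdifferentiableAt_symm hy)).symm

/-- The differential at `x` of the preferred chart at `x₀`. -/
def dChart (x₀ x : X) : TangentSpace (𝓡 n) x →L[ℝ] EuclideanSpace ℝ (Fin n) :=
  mfderiv (𝓡 n) 𝓘(ℝ, EuclideanSpace ℝ (Fin n)) (extChartAt (𝓡 n) x₀) x

theorem fderiv_comp_dChart {F : Type*} [NormedAddCommGroup F] [NormedSpace ℝ F] {g : X → F}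
    (hg : ContMDiff (𝓡 n) 𝓘(ℝ, F) ∞ g) {x₀ x : X} (hx : x ∈ (extChartAt (𝓡 n) x₀).source) :
    (fderiv ℝ (g ∘ (extChartAt (𝓡 n) x₀).symm) (extChartAt (𝓡 n) x₀ x)).comp (dChart x₀ x) =
      dFun g x := by
  have : IsManifold (𝓡 n) 1 X := isManifold_one
  have h1 : DifferentiableAt ℝ (g ∘ (extChartAt (𝓡 n) x₀).symm) (extChartAt (𝓡 n) x₀ x) :=
    ((contDiffOn_comp_symm hg x₀).contDiffAt ((isOpen_extChartAt_target x₀).mem_nhds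
      ((extChartAt (𝓡 n) x₀).map_source hx))).differentiableAt (by simp)
  rw [← mfderiv_eq_fderiv]
  refine (mfderiv_comp x h1.mdifferentiableAt
    (mdifferentiableAt_extChartAt (by rwa [extChartAt_source] at hx))).symm.trans ?_
  refine Filter.EventuallyEq.mfderiv_eq ?_
  filter_upwards [(isOpen_extChartAt_source (I := 𝓡 n) x₀).mem_nhds hx] with y hy
  exact congrArg g ((extChartAt (𝓡 n) x₀).left_inv hy)

theorem inChart_monForm {p : ℕ} (φ : X → ℂ) {g : Fin p → X → ℂ}
    (hg : ∀ i, ContMDiff (𝓡 n) 𝓘(ℝ, ℂ) ∞ (g i)) {x₀ : X} {y : EuclideanSpace ℝ (Fin n)}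
    (hy : y ∈ (extChartAt (𝓡 n) x₀).target) :
    inChart x₀ (monForm φ g) y = (φ ∘ (extChartAt (𝓡 n) x₀).symm) y •
      detForm fun i => fderiv ℝ (g i ∘ (extChartAt (𝓡 n) x₀).symm) y := by
  have h : inChart x₀ (monForm φ g) y = (φ ∘ (extChartAt (𝓡 n) x₀).symm) y •
      (detForm fun i => dFun (g i)
        ((extChartAt (𝓡 n) x₀).symm y)).compContinuousLinearMap (dSymm x₀ y) := rfl
  rw [h, detForm_compContinuousLinearMap]
  congr 2
  funext i
  exact dFun_comp_dSymm (hg i) hy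

theorem isSmooth_monForm {p : ℕ} {φ : X → ℂ} (hφ : ContMDiff (𝓡 n) 𝓘(ℝ, ℂ) ∞ φ)
    {g : Fin p → X → ℂ} (hg : ∀ i, ContMDiff (𝓡 n) 𝓘(ℝ, ℂ) ∞ (g i)) :
    IsSmooth (monForm (n := n) φ g) := by
  intro x₀
  rw [Set.preimage_univ, Set.inter_univ]
  refine ContDiffOn.congr ?_ fun y hy => inChart_monForm φ hg hy
  refine (contDiffOn_comp_symm hφ x₀).smul (contDiffOn_detForm fun i => ?_)
  exact (contDiffOn_comp_symm (hg i) x₀).fderiv_of_isOpen (isOpen_extChartAt_target x₀) (by simp)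

theorem extD_monForm {p : ℕ} {φ : X → ℂ} (hφ : ContMDiff (𝓡 n) 𝓘(ℝ, ℂ) ∞ φ)
    {g : Fin p → X → ℂ} (hg : ∀ i, ContMDiff (𝓡 n) 𝓘(ℝ, ℂ) ∞ (g i)) :
    extD (monForm (n := n) φ g) = fun x => detForm fun i =>
      dFun (Fin.cons (α := fun _ => X → ℂ) φ g i) x := by
  funext x
  have hev : inChart x (monForm φ g) =ᶠ[nhds (extChartAt (𝓡 n) x x)] fun y =>
      (φ ∘ (extChartAt (𝓡 n) x).symm) y •
        detForm fun i => fderiv ℝ (g i ∘ (extChartAt (𝓡 n) x).symm) y := by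
    filter_upwards [extChartAt_target_mem_nhds x] with y hy using inChart_monForm φ hg hy
  have hc : ∀ f : X → ℂ, ContMDiff (𝓡 n) 𝓘(ℝ, ℂ) ∞ f →
      ContDiffAt ℝ ∞ (f ∘ (extChartAt (𝓡 n) x).symm) (extChartAt (𝓡 n) x x) := fun f hf =>
    (contDiffOn_comp_symm hf x).contDiffAt (extChartAt_target_mem_nhds x)
  rw [extD, hev.extDeriv_eq, extDeriv_smul_detForm (hc φ hφ) fun i => hc _ (hg i)]
  refine (detForm_compContinuousLinearMap _ _).trans ?_
  congr 1
  funext i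
  refine Fin.cases ?_ (fun i => ?_) i
  · exact fderiv_comp_dChart hφ (mem_extChartAt_source x)
  · exact fderiv_comp_dChart (hg i) (mem_extChartAt_source x)

end Charts

theorem inChart_sum {ι : Type*} (s : Finset ι) {k : ℕ} (x₀ : X) (a : ι → DiffForm n X k) :
    inChart x₀ (∑ i ∈ s, a i) = fun y => ∑ i ∈ s, inChart x₀ (a i) y := by
  funext y
  ext v
  simp only [inChart, Finset.sum_apply]
  rw [ContinuousAlternatingMap.sum_apply]
  exact ContinuousAlternatingMap.sum_apply _ _

theorem isSmooth_sum {ι : Type*} (s : Finset ι) {k : ℕ} {a : ι → DiffForm n X k}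
    (ha : ∀ i ∈ s, IsSmooth (a i)) : IsSmooth (∑ i ∈ s, a i) := by
  intro x₀
  rw [inChart_sum]
  exact ContDiffOn.sum fun i hi => ha i hi x₀

theorem extD_sum {ι : Type*} (s : Finset ι) {k : ℕ} {a : ι → DiffForm n X k}
    (ha : ∀ i ∈ s, IsSmooth (a i)) : extD (∑ i ∈ s, a i) = ∑ i ∈ s, extD (a i) := by
  funext x
  have hd : ∀ i ∈ s, DifferentiableAt ℝ (inChart x (a i)) (extChartAt (𝓡 n) x x) := by
    intro i hi
    refine ((ha i hi x).contDiffAt ?_).differentiableAt (by simp)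
    simpa using extChartAt_target_mem_nhds (I := 𝓡 n) x
  rw [extD, inChart_sum, extDeriv, fderiv_fun_sum hd]
  ext v
  simp only [Finset.sum_apply]
  refine Eq.trans ?_ (ContinuousAlternatingMap.sum_apply _ _).symm
  simp only [extD, extDeriv, ← ContinuousAlternatingMap.alternatizeUncurryFinCLM_apply, map_sum]
  exact ContinuousAlternatingMap.sum_apply _ _

end

/-! ### Immersion into a Euclidean space of dimension `2n + 1` -/

section

variable {n : ℕ} {X : Type*} [TopologicalSpace X] [ChartedSpace (EuclideanSpace ℝ (Fin n)) X]

theorem dFun_congr {F : Type*} [NormedAddCommGroup F] [NormedSpace ℝ F] {f g : X → F} {x : X}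
    (h : f =ᶠ[nhds x] g) : dFun (n := n) f x = dFun g x :=
  h.mfderiv_eq

theorem dFun_add_smul {F : Type*} [NormedAddCommGroup F] [NormedSpace ℝ F] {f : X → F} {g : X → ℝ}
    (hf : ContMDiff (𝓡 n) 𝓘(ℝ, F) ∞ f) (hg : ContMDiff (𝓡 n) 𝓘(ℝ, ℝ) ∞ g) (c : F) (x : X)
    (v : TangentSpace (𝓡 n) x) :
    dFun (fun y => f y + g y • c) x v = dFun f x v + dFun g x v • c := by
  have h1 : HasMFDerivAt (𝓡 n) 𝓘(ℝ, F) f x (dFun f x) :=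
    (hf.mdifferentiableAt (by simp)).hasMFDerivAt
  have h2 : HasMFDerivAt (𝓡 n) 𝓘(ℝ, ℝ) g x (dFun g x) :=
    (hg.mdifferentiableAt (by simp)).hasMFDerivAt
  have h3 := ((ContinuousLinearMap.toSpanSingleton ℝ c).hasMFDerivAt (x := g x)).comp x h2
  have h4 := (h1.add h3).mfderiv
  exact congrArg (fun L => L v) h4

theorem contMDiff_clm_comp {F F' : Type*} [NormedAddCommGroup F] [NormedSpace ℝ F]
    [NormedAddCommGroup F'] [NormedSpace ℝ F'] (L : F →L[ℝ] F') {g : X → F}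
    (hg : ContMDiff (𝓡 n) 𝓘(ℝ, F) ∞ g) : ContMDiff (𝓡 n) 𝓘(ℝ, F') ∞ (fun y => L (g y)) :=
  L.contMDiff.comp hg

theorem dFun_clm_comp {F F' : Type*} [NormedAddCommGroup F] [NormedSpace ℝ F]
    [NormedAddCommGroup F'] [NormedSpace ℝ F'] (L : F →L[ℝ] F') {g : X → F}
    (hg : ContMDiff (𝓡 n) 𝓘(ℝ, F) ∞ g) (x : X) :
    dFun (fun y => L (g y)) x = L.comp (dFun (n := n) g x) :=
  ((L.hasMFDerivAt (x := g x)).comp x (hg.mdifferentiableAt (by simp)).hasMFDerivAt).mfderiv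

variable [IsManifold (𝓡 n) ∞ X]

/-- A smooth map to a space of dimension more than `2 n` has a vector which is not the image of a
tangent vector. -/
theorem exists_notMem_range_dFun [SecondCountableTopology X] {F : Type*} [NormedAddCommGroup F]
    [NormedSpace ℝ F] [FiniteDimensional ℝ F] (hF : 2 * n < Module.finrank ℝ F) {G : X → F}
    (hG : ContMDiff (𝓡 n) 𝓘(ℝ, F) ∞ G) :
    ∃ c : F, ∀ (x : X) (v : TangentSpace (𝓡 n) x), dFun G x v ≠ c := by
  let E := EuclideanSpace ℝ (Fin n)
  obtain ⟨S, hS, hcov⟩ := TopologicalSpace.countable_cover_nhds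
    (fun x : X => extChartAt_source_mem_nhds (I := 𝓡 n) x)
  let D : X → E × E → F := fun x₀ z => fderiv ℝ (G ∘ (extChartAt (𝓡 n) x₀).symm) z.1 z.2
  -- `B` contains every value of `dG`: it is a countable union of `C^1` images of open subsets of a
  -- `2n`-dimensional space, so its Hausdorff dimension is at most `2n` and its complement is dense.
  let B : Set F := ⋃ x₀ ∈ S, D x₀ '' ((extChartAt (𝓡 n) x₀).target ×ˢ Set.univ)
  have hB : dimH B < Module.finrank ℝ F := by
    refine lt_of_le_of_lt (b := ((2 * n : ℕ) : ENNReal)) ?_ (by exact_mod_cast hF)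
    rw [dimH_bUnion hS]
    refine iSup₂_le fun x₀ _ => ?_
    have hopen : IsOpen ((extChartAt (𝓡 n) x₀).target ×ˢ (Set.univ : Set E)) :=
      (isOpen_extChartAt_target x₀).prod isOpen_univ
    have hD : ContDiffOn ℝ 1 (D x₀) ((extChartAt (𝓡 n) x₀).target ×ˢ (Set.univ : Set E)) := by
      have h1 : ContDiffOn ℝ 1 (fderiv ℝ (G ∘ (extChartAt (𝓡 n) x₀).symm))
          (extChartAt (𝓡 n) x₀).target :=
        (contDiffOn_comp_symm hG x₀).fderiv_of_isOpen (isOpen_extChartAt_target x₀)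
          (WithTop.coe_le_coe.2 le_top)
      exact (h1.comp contDiffOn_fst fun z hz => hz.1).clm_apply contDiffOn_snd
    refine (dimH_image_le_of_locally_lipschitzOn fun z hz => ?_).trans ?_
    · obtain ⟨K, t, ht, hL⟩ := (hD.contDiffAt (hopen.mem_nhds hz)).exists_lipschitzOnWith
      exact ⟨K, t, mem_nhdsWithin_of_mem_nhds ht, hL⟩
    · refine (dimH_mono (Set.subset_univ _)).trans ?_
      rw [Real.dimH_univ_eq_finrank, Module.finrank_prod]
      simp [E, two_mul]
  obtain ⟨c, hc⟩ := (dense_compl_of_dimH_lt_finrank hB).nonempty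
  refine ⟨c, fun x v h => hc ?_⟩
  obtain ⟨x₀, hx₀, hx⟩ := Set.mem_iUnion₂.1 (hcov.symm ▸ Set.mem_univ x : x ∈ ⋃ x₀ ∈ S, _)
  refine Set.mem_iUnion₂.2 ⟨x₀, hx₀, (extChartAt (𝓡 n) x₀ x, dChart x₀ x v),
    ⟨(extChartAt (𝓡 n) x₀).map_source hx, Set.mem_univ _⟩, ?_⟩
  rw [← h, ← fderiv_comp_dChart hG hx]
  rfl

theorem dChart_injective {x₀ x : X} (hx : x ∈ (extChartAt (𝓡 n) x₀).source) :
    Function.Injective (dChart (n := n) x₀ x) := by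
  have : IsManifold (𝓡 n) 1 X := isManifold_one
  exact (isInvertible_mfderiv_extChartAt hx).bijective.1

/-- There is a locally finite sequence of smooth functions whose differentials span all cotangent
spaces. -/
theorem exists_seq_span_cotangent [T2Space X] [SecondCountableTopology X] :
    ∃ h : ℕ → X → ℝ, (∀ l, ContMDiff (𝓡 n) 𝓘(ℝ, ℝ) ∞ (h l)) ∧
      (∀ x, ∃ J, ∀ᶠ y in nhds x, ∀ l, J ≤ l → h l y = 0) ∧
      ∀ (x : X) (v : TangentSpace (𝓡 n) x), (∀ l, dFun (h l) x v = 0) → v = 0 := by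
  classical
  have : LocallyCompactSpace X := ChartedSpace.locallyCompactSpace (EuclideanSpace ℝ (Fin n)) X
  obtain ⟨ι, f, -⟩ := SmoothBumpCovering.exists_isSubordinate (𝓡 n) (isClosed_univ (X := X))
    (U := fun _ => Set.univ) fun _ _ => Filter.univ_mem
  have : Countable ι := Set.countable_univ_iff.1
    (f.locallyFinite.countable_univ fun i => (f i).nonempty_support)
  let := Encodable.ofCountable (ι × Fin n)
  let L : Fin n → EuclideanSpace ℝ (Fin n) →L[ℝ] ℝ := fun a => EuclideanSpace.proj a
  -- Bump function times chart coordinate: where the bump is 1, these have the differentials of the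
  -- chart coordinates.
  let k : ι × Fin n → X → ℝ := fun p x => f p.1 x • L p.2 (extChartAt (𝓡 n) (f.c p.1) x)
  have hk : ∀ p, ContMDiff (𝓡 n) 𝓘(ℝ, ℝ) ∞ (k p) := fun p =>
    (f p.1).contMDiff_smul ((L p.2).contMDiff.comp_contMDiffOn contMDiffOn_extChartAt)
  -- With `decode₂` each index pair occurs for exactly one `l`, which local finiteness requires.
  let h : ℕ → X → ℝ := fun l => (Encodable.decode₂ (ι × Fin n) l).elim 0 k
  have hdec : ∀ p, h (Encodable.encode p) = k p := fun p => by
    simp only [h, Encodable.decode₂_encode, Option.elim_some]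
  refine ⟨h, fun l => ?_, fun x => ?_, fun x v hv => ?_⟩
  · simp only [h]
    cases Encodable.decode₂ (ι × Fin n) l with
    | none => exact contMDiff_const
    | some p => exact hk p
  · obtain ⟨U, hU, hfin⟩ := f.locallyFinite x
    let T : Set ℕ := Encodable.encode '' ({i | (Function.support (f i) ∩ U).Nonempty} ×ˢ
      (Set.univ : Set (Fin n)))
    have hT : T.Finite := (hfin.prod Set.finite_univ).image _
    obtain ⟨J, hJ⟩ := hT.bddAbove
    refine ⟨J + 1, ?_⟩
    filter_upwards [hU] with y hy l hl
    by_contra hne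
    rcases hd : Encodable.decode₂ (ι × Fin n) l with _ | p
    · simp [h, hd] at hne
    · have hp : Encodable.encode p = l := Encodable.mem_decode₂.1 hd
      have hne' : k p y ≠ 0 := by rwa [← hdec, hp]
      have hmem : l ∈ T := ⟨p, ⟨⟨y, left_ne_zero_of_smul hne', hy⟩, Set.mem_univ _⟩, hp⟩
      have := hJ hmem
      omega
  · let i := f.ind x (Set.mem_univ x)
    have hx : x ∈ (extChartAt (𝓡 n) (f.c i)).source := f.mem_extChartAt_ind_source x _
    have : IsManifold (𝓡 n) 1 X := isManifold_one
    refine dChart_injective hx ?_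
    rw [map_zero]
    ext a
    have h1 : HasMFDerivAt (𝓡 n) 𝓘(ℝ, ℝ) (fun y => L a (extChartAt (𝓡 n) (f.c i) y)) x
        ((L a).comp (dChart (f.c i) x)) :=
      (L a).hasMFDerivAt.comp x (mdifferentiableAt_extChartAt (I := 𝓡 n) (x := f.c i)
        (by rwa [extChartAt_source] at hx)).hasMFDerivAt
    have h2 : dFun (n := n) (k (i, a)) x = (L a).comp (dChart (f.c i) x) := by
      refine Eq.trans (dFun_congr ?_) h1.mfderiv
      filter_upwards [f.eventuallyEq_one x (Set.mem_univ x)] with y hy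
      simp only [k]
      rw [show f i y = 1 from hy, one_smul]
    have h3 := hv (Encodable.encode (i, a))
    rw [hdec, h2] at h3
    exact h3

/-- Weak Whitney immersion theorem. -/
theorem exists_immersion [T2Space X] [SecondCountableTopology X] :
    ∃ G : X → EuclideanSpace ℝ (Fin (2 * n + 1)),
      ContMDiff (𝓡 n) 𝓘(ℝ, EuclideanSpace ℝ (Fin (2 * n + 1))) ∞ G ∧
        ∀ x, Function.Injective (dFun (n := n) G x) := by
  let F := EuclideanSpace ℝ (Fin (2 * n + 1))
  obtain ⟨h, hs, hfin, hspan⟩ := exists_seq_span_cotangent (n := n) (X := X)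
  -- Invariant: `dG` together with the `dh_l` for `l ≥ j` is injective on every tangent space. The
  -- induction removes one `h_j` at a time.
  let P : ℕ → (X → F) → Prop := fun j G => ContMDiff (𝓡 n) 𝓘(ℝ, F) ∞ G ∧
    ∀ (x : X) (v : TangentSpace (𝓡 n) x), dFun G x v = 0 →
      (∀ l, j ≤ l → dFun (h l) x v = 0) → v = 0
  have step : ∀ j G, P j G → ∃ G', P (j + 1) G' ∧ ∃ c, ∀ y, G' y = G y + h j y • c := by
    rintro j G ⟨hG, hinj⟩
    -- Replace `G` by `G - h_j c` with `c` outside all images of `dG`. If `dG v = dh_j(v) c`, then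
    -- `dh_j(v) = 0`, as otherwise dividing by it puts `c` in the image.
    obtain ⟨c, hc⟩ := exists_notMem_range_dFun (F := F) (by simp [F]) hG
    refine ⟨fun y => G y + h j y • -c, ⟨?_, fun x v h0 hl => ?_⟩, -c, fun _ => rfl⟩
    · exact hG.add ((hs j).smul contMDiff_const)
    · rw [dFun_add_smul hG (hs j), smul_neg, add_neg_eq_zero] at h0
      have h1 : dFun (h j) x v = 0 := by
        by_contra hne
        refine hc x ((dFun (h j) x v)⁻¹ • v) ?_
        rw [map_smul, h0, smul_smul, inv_mul_cancel₀ hne, one_smul]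
      refine hinj x v (by rw [h0, h1, zero_smul]) fun l hjl => ?_
      rcases hjl.eq_or_lt with rfl | hlt
      · exact h1
      · exact hl l hlt
  have zero : P 0 fun _ => 0 := ⟨contMDiff_const, fun x v _ hl => hspan x v fun l => hl l l.zero_le⟩
  choose! next hnext c hc using step
  let G : ℕ → X → F := fun j => Nat.rec (fun _ => 0) (fun j g => next j g) j
  have hG : ∀ j, P j (G j) := fun j => by
    induction j with
    | zero => exact zero
    | succ j ih => exact hnext j _ ih
  choose J hJ using hfin
  have hstab : ∀ x, ∀ᶠ y in nhds x, ∀ l, J x ≤ l → G l y = G (J x) y := by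
    intro x
    filter_upwards [hJ x] with y hy l hl
    induction l, hl using Nat.le_induction with
    | base => rfl
    | succ l hl ih =>
      have : G (l + 1) y = G l y + h l y • c l (G l) := hc l _ (hG l) y
      rw [this, hy l hl, zero_smul, add_zero, ih]
  -- The sequence is locally stationary, so its limit is smooth. The index `J y` may jump with `y`;
  -- the values at `J x` and `J y` are compared through their maximum.
  have hlim : ∀ x, (fun y => G (J y) y) =ᶠ[nhds x] G (J x) := by
    intro x
    filter_upwards [hstab x] with y hy
    rw [← hy (max (J x) (J y)) (le_max_left _ _)]
    exact ((hstab y).self_of_nhds _ (le_max_right _ _)).symm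
  refine ⟨fun y => G (J y) y, fun x => ((hG (J x)).1 x).congr_of_eventuallyEq (hlim x), fun x => ?_⟩
  rw [injective_iff_map_eq_zero]
  intro v hv
  rw [dFun_congr (hlim x)] at hv
  refine (hG (J x)).2 x v hv fun l hl => ?_
  have : h l =ᶠ[nhds x] fun _ => 0 := by
    filter_upwards [hJ x] with y hy using hy l hl
  rw [dFun_congr this]
  have h0 : mfderiv (𝓡 n) 𝓘(ℝ, ℝ) (fun _ : X => (0 : ℝ)) x = 0 := mfderiv_const
  exact congrArg (fun L => L v) h0

end

section

/-! ### Left inverses of an immersion and the decomposition into monomials -/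

section PseudoInverse

variable {E F : Type*} [NormedAddCommGroup E] [InnerProductSpace ℝ E] [FiniteDimensional ℝ E]
  [NormedAddCommGroup F] [InnerProductSpace ℝ F] [FiniteDimensional ℝ F]

/-- The left inverse of an injective linear map that vanishes on the orthogonal complement of its
range. -/
def pinv (D : E →L[ℝ] F) : F →L[ℝ] E :=
  (Ring.inverse ((ContinuousLinearMap.adjoint D).comp D)).comp (ContinuousLinearMap.adjoint D)

theorem isUnit_adjoint_comp_self {D : E →L[ℝ] F} (hD : Function.Injective D) :
    IsUnit ((ContinuousLinearMap.adjoint D).comp D) := by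
  have hi : Function.Injective ((ContinuousLinearMap.adjoint D).comp D) := by
    rw [injective_iff_map_eq_zero]
    intro v hv
    have h : inner ℝ (D v) (D v) = 0 := by
      rw [← ContinuousLinearMap.adjoint_inner_left]
      exact (congrArg (fun w => inner ℝ w v) hv).trans (inner_zero_left v)
    exact (injective_iff_map_eq_zero D).1 hD v (inner_self_eq_zero.1 h)
  exact ContinuousLinearMap.isUnit_iff_bijective.2 ⟨hi, LinearMap.injective_iff_surjective.1 hi⟩

/-- The normal equation of least squares: `D* D (pinv D w) = D* w`. -/
theorem inner_pinv_sub {D : E →L[ℝ] F} (hD : Function.Injective D) (w : F) (u : E) :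
    inner ℝ (D (pinv D w) - w) (D u) = 0 := by
  have h := Ring.mul_inverse_cancel _ (isUnit_adjoint_comp_self hD)
  rw [← ContinuousLinearMap.adjoint_inner_left, map_sub]
  have h' : ContinuousLinearMap.adjoint D (D (pinv D w)) = ContinuousLinearMap.adjoint D w :=
    congrArg (fun L : E →L[ℝ] E => L (ContinuousLinearMap.adjoint D w)) h
  rw [h', sub_self, inner_zero_left]

/-- Only the inner product of the target enters, so the least-squares solution does not depend on a
metric on the source. This allows comparison of the pseudo-inverse on a tangent space with that in a
chart. -/
theorem eq_of_inner_sub {F : Type*} [NormedAddCommGroup F] [InnerProductSpace ℝ F]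
    {V : Type*} [AddCommGroup V] [Module ℝ V] [TopologicalSpace V]
    {D : V →L[ℝ] F} (hD : Function.Injective D) {w : F} {a b : V}
    (ha : ∀ u, inner ℝ (D a - w) (D u) = 0) (hb : ∀ u, inner ℝ (D b - w) (D u) = 0) : a = b := by
  apply hD
  rw [← sub_eq_zero, ← inner_self_eq_zero (𝕜 := ℝ)]
  have h : inner ℝ (D a - w - (D b - w)) (D (a - b)) = 0 := by
    rw [inner_sub_left, ha, hb, sub_zero]
  simpa using h

theorem pinv_apply_self {D : E →L[ℝ] F} (hD : Function.Injective D) (v : E) :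
    pinv D (D v) = v :=
  eq_of_inner_sub hD (inner_pinv_sub hD (D v)) fun u => by rw [sub_self, inner_zero_left]

/-- Taking adjoints is linear, and inversion is smooth at the invertible operator `D* D`. -/
theorem contDiffOn_pinv {E' : Type*} [NormedAddCommGroup E'] [NormedSpace ℝ E'] {r : ℕ∞ω}
    {s : Set E'} {D : E' → E →L[ℝ] F} (hD : ContDiffOn ℝ r D s)
    (hi : ∀ y ∈ s, Function.Injective (D y)) : ContDiffOn ℝ r (fun y => pinv (D y)) s := by
  let adj : (E →L[ℝ] F) →ₗ[ℝ] F →L[ℝ] E :=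
    { toFun := fun L => ContinuousLinearMap.adjoint L
      map_add' := fun a b => map_add _ a b
      map_smul' := fun c a => by simp }
  have hadj : ContDiffOn ℝ r (fun y => ContinuousLinearMap.adjoint (D y)) s :=
    (ContinuousLinearMap.contDiff (LinearMap.toContinuousLinearMap adj)).comp_contDiffOn hD
  refine ContDiffOn.clm_comp (fun y hy => ?_) hadj
  obtain ⟨U, hU⟩ := isUnit_adjoint_comp_self (hi y hy)
  have h := contDiffAt_ringInverse (n := r) ℝ U
  rw [hU] at h
  exact h.comp_contDiffWithinAt y (hadj.clm_comp hD y hy)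

end PseudoInverse

/-- The coordinates of a Euclidean space, as complex-valued linear forms. -/
def coordC {q : ℕ} (i : Fin q) : EuclideanSpace ℝ (Fin q) →L[ℝ] ℂ :=
  Complex.ofRealCLM.comp (EuclideanSpace.proj i)

/-- Insert `v = ∑ (D v)_i P e_i` in every slot of `α`. The sum runs over all multi-indices and not
only increasing ones, so each of the `p!` permutations in the determinant contributes one copy of
`α`. -/
theorem sum_smul_detForm {W : Type*} [AddCommGroup W] [Module ℝ W] [TopologicalSpace W] {p q : ℕ}
    (α : W [⋀^Fin p]→L[ℝ] ℂ) (D : W →L[ℝ] EuclideanSpace ℝ (Fin q))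
    (P : EuclideanSpace ℝ (Fin q) →L[ℝ] W) (hP : ∀ v, P (D v) = v) :
    ∑ I : Fin p → Fin q, α (fun j => P (EuclideanSpace.single (I j) 1)) •
      detForm (fun j => (coordC (I j)).comp D) = (p.factorial : ℂ) • α := by
  have hexp : ∀ v : W, v = ∑ i, D v i • P (EuclideanSpace.single i 1) := by
    intro v
    conv_lhs => rw [← hP v, ← (EuclideanSpace.basisFun (Fin q) ℝ).sum_repr (D v), map_sum]
    simp
  have hα : ∀ v : Fin p → W, α v = ∑ I : Fin p → Fin q,
      (∏ j, ((D (v j) (I j) : ℝ) : ℂ)) * α fun j => P (EuclideanSpace.single (I j) 1) := by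
    intro v
    conv_lhs => rw [show v = fun j => ∑ i, D (v j) i • P (EuclideanSpace.single i 1) from
      funext fun j => hexp (v j)]
    rw [α.map_sum]
    refine Finset.sum_congr rfl fun I _ => ?_
    rw [α.map_smul_univ (fun j => D (v j) (I j)) fun j => P (EuclideanSpace.single (I j) 1)]
    simp
  ext v
  rw [ContinuousAlternatingMap.sum_apply]
  simp only [ContinuousAlternatingMap.smul_apply, detForm_apply_sum, Finset.smul_sum]
  rw [Finset.sum_comm]
  have h : ∀ σ : Equiv.Perm (Fin p), ∑ I : Fin p → Fin q,
      α (fun j => P (EuclideanSpace.single (I j) 1)) • (Equiv.Perm.sign σ •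
        ∏ j, (coordC (I j)).comp D (v (σ j))) = α v := by
    intro σ
    have h1 : α (v ∘ σ) = Equiv.Perm.sign σ • α v := α.toAlternatingMap.map_perm v σ
    have h2 : α v = Equiv.Perm.sign σ • α (v ∘ σ) := by
      rw [h1, smul_smul, Int.units_mul_self, one_smul]
    rw [h2, hα, Finset.smul_sum]
    refine Finset.sum_congr rfl fun I _ => ?_
    simp only [Units.smul_def, zsmul_eq_mul, smul_eq_mul]
    have h3 : ∏ j, (coordC (I j)).comp D (v (σ j)) = ∏ j, ((D ((v ∘ σ) j) (I j) : ℝ) : ℂ) := rfl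
    rw [h3]
    ring
  simp only [h]
  simp [Fintype.card_perm]

variable {n : ℕ} {X : Type*} [TopologicalSpace X] [ChartedSpace (EuclideanSpace ℝ (Fin n)) X]
variable [IsManifold (𝓡 n) ∞ X]

theorem dSymm_surjective {x₀ : X} {y : EuclideanSpace ℝ (Fin n)}
    (hy : y ∈ (extChartAt (𝓡 n) x₀).target) : Function.Surjective (dSymm x₀ y) := by
  have : IsManifold (𝓡 n) 1 X := isManifold_one
  have h := (isInvertible_mfderivWithin_extChartAt_symm (I := 𝓡 n) hy).bijective.2
  have hr : Set.range (𝓡 n) = Set.univ := by simp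
  rw [hr, mfderivWithin_univ] at h
  exact h

/-- The pseudo-inverse of the differential of an immersion. -/
def dInv {q : ℕ} (G : X → EuclideanSpace ℝ (Fin q)) (x : X) :
    EuclideanSpace ℝ (Fin q) →L[ℝ] TangentSpace (𝓡 n) x :=
  pinv (E := EuclideanSpace ℝ (Fin n)) (dFun (n := n) G x)

/-- Both sides solve the same least-squares problem, because the differential of the inverse chart
is onto the tangent space. Smoothness of `dInv` can thus be read off in charts. -/
theorem dInv_eq {q : ℕ} {G : X → EuclideanSpace ℝ (Fin q)}
    (hG : ContMDiff (𝓡 n) 𝓘(ℝ, EuclideanSpace ℝ (Fin q)) ∞ G)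
    (hi : ∀ x, Function.Injective (dFun (n := n) G x)) {x₀ : X} {y : EuclideanSpace ℝ (Fin n)}
    (hy : y ∈ (extChartAt (𝓡 n) x₀).target)
    (hj : Function.Injective (fderiv ℝ (G ∘ (extChartAt (𝓡 n) x₀).symm) y))
    (w : EuclideanSpace ℝ (Fin q)) :
    dInv G ((extChartAt (𝓡 n) x₀).symm y) w =
      dSymm x₀ y (pinv (fderiv ℝ (G ∘ (extChartAt (𝓡 n) x₀).symm) y) w) := by
  have hc := dFun_comp_dSymm hG hy
  have hc' : ∀ u, dFun G ((extChartAt (𝓡 n) x₀).symm y) (dSymm x₀ y u) =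
      fderiv ℝ (G ∘ (extChartAt (𝓡 n) x₀).symm) y u := fun u => congrArg (fun L => L u) hc
  refine eq_of_inner_sub (hi ((extChartAt (𝓡 n) x₀).symm y)) (w := w)
    (inner_pinv_sub (E := EuclideanSpace ℝ (Fin n)) (hi _) w) fun u => ?_
  obtain ⟨u, rfl⟩ := dSymm_surjective hy u
  rw [hc', hc']
  exact inner_pinv_sub hj w u

theorem contMDiff_apply_dInv {q p : ℕ} {G : X → EuclideanSpace ℝ (Fin q)}
    (hG : ContMDiff (𝓡 n) 𝓘(ℝ, EuclideanSpace ℝ (Fin q)) ∞ G)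
    (hi : ∀ x, Function.Injective (dFun (n := n) G x)) {α : DiffForm n X p} (hα : IsSmooth α)
    (w : Fin p → EuclideanSpace ℝ (Fin q)) :
    ContMDiff (𝓡 n) 𝓘(ℝ, ℂ) ∞ fun x => α x fun j => dInv G x (w j) := by
  intro x₀
  let ψ : EuclideanSpace ℝ (Fin n) → ℂ := fun y =>
    inChart x₀ α y fun j => pinv (fderiv ℝ (G ∘ (extChartAt (𝓡 n) x₀).symm) y) (w j)
  have hj : ∀ y ∈ (extChartAt (𝓡 n) x₀).target,
      Function.Injective (fderiv ℝ (G ∘ (extChartAt (𝓡 n) x₀).symm) y) := by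
    intro y hy
    rw [← dFun_comp_dSymm hG hy]
    refine (hi _).comp ?_
    have : IsManifold (𝓡 n) 1 X := isManifold_one
    have h := (isInvertible_mfderivWithin_extChartAt_symm (I := 𝓡 n) hy).bijective.1
    have hr : Set.range (𝓡 n) = Set.univ := by simp
    rw [hr, mfderivWithin_univ] at h
    exact h
  have hψ : ContDiffOn ℝ ∞ ψ (extChartAt (𝓡 n) x₀).target := by
    refine contDiffOn_alternating_apply (by simpa using hα x₀) fun j => ?_
    refine ContDiffOn.clm_apply (contDiffOn_pinv ?_ hj) contDiffOn_const
    exact (contDiffOn_comp_symm hG x₀).fderiv_of_isOpen (isOpen_extChartAt_target x₀) (by simp)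
  have hψ' : ContMDiffAt (𝓡 n) 𝓘(ℝ, ℂ) ∞ (ψ ∘ extChartAt (𝓡 n) x₀) x₀ :=
    (hψ.contDiffAt (extChartAt_target_mem_nhds x₀)).contMDiffAt.comp x₀ contMDiffAt_extChartAt
  refine hψ'.congr_of_eventuallyEq ?_
  filter_upwards [extChartAt_source_mem_nhds (I := 𝓡 n) x₀] with x hx
  have hy := (extChartAt (𝓡 n) x₀).map_source hx
  have hx' := (extChartAt (𝓡 n) x₀).left_inv hx
  have key : ∀ y ∈ (extChartAt (𝓡 n) x₀).target,
      (fun x => α x fun j => dInv G x (w j)) ((extChartAt (𝓡 n) x₀).symm y) = ψ y := by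
    intro y hy
    simp only [dInv_eq hG hi hy (hj y hy)]
    rfl
  have := key _ hy
  rw [hx'] at this
  exact this

/-- Every smooth form is a finite sum of forms `φ • dg 0 ∧ … ∧ dg (p - 1)`. -/
theorem exists_eq_sum_monForm [T2Space X] [SecondCountableTopology X] {p : ℕ}
    {α : DiffForm n X p} (hα : IsSmooth α) :
    ∃ (N : ℕ) (φ : (Fin p → Fin N) → X → ℂ) (g : (Fin p → Fin N) → Fin p → X → ℂ),
      (∀ I, ContMDiff (𝓡 n) 𝓘(ℝ, ℂ) ∞ (φ I)) ∧
      (∀ I j, ContMDiff (𝓡 n) 𝓘(ℝ, ℂ) ∞ (g I j)) ∧ α = ∑ I, monForm (φ I) (g I) := by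
  obtain ⟨G, hG, hi⟩ := exists_immersion (n := n) (X := X)
  -- The functions are the coordinates of the immersion, and the coefficients are `α` on the vectors
  -- `P e_i`, divided by the overcounting factor `p!`.
  refine ⟨2 * n + 1, fun I x => (p.factorial : ℂ)⁻¹ *
      α x fun j => dInv G x (EuclideanSpace.single (I j) 1), fun I j x => coordC (I j) (G x),
    fun I => contMDiff_clm_comp (ContinuousLinearMap.mul ℝ ℂ _) (contMDiff_apply_dInv hG hi hα _),
    fun I j => contMDiff_clm_comp _ hG, ?_⟩
  funext x
  have h := sum_smul_detForm (α x) (dFun G x) (dInv G x)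
    (pinv_apply_self (E := EuclideanSpace ℝ (Fin n)) (hi x))
  have hp : (p.factorial : ℂ) ≠ 0 := by exact_mod_cast p.factorial_ne_zero
  have h' : α x = (p.factorial : ℂ)⁻¹ • (p.factorial : ℂ) • α x := by
    rw [smul_smul, inv_mul_cancel₀ hp, one_smul]
  rw [h', ← h, Finset.smul_sum, Finset.sum_apply]
  refine Finset.sum_congr rfl fun I _ => ?_
  simp only [monForm, dFun_clm_comp _ hG, smul_smul]

end

/-! ### Chern characters of diagonal connections -/

section

variable {n : ℕ} {X : Type*} [TopologicalSpace X] [ChartedSpace (EuclideanSpace ℝ (Fin n)) X]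

theorem inChart_smul {k : ℕ} (x₀ : X) (c : ℂ) (a : DiffForm n X k) :
    inChart x₀ (c • a) = fun y => c • inChart x₀ a y := rfl

theorem IsSmooth.const_smul {k : ℕ} {a : DiffForm n X k} (ha : IsSmooth a) (c : ℂ) :
    IsSmooth (c • a) := by
  intro x₀
  rw [inChart_smul]
  exact ContDiffOn.const_smul c (ha x₀)

theorem extD_smul {k : ℕ} {a : DiffForm n X k} (ha : IsSmooth a) (c : ℂ) :
    extD (c • a) = c • extD a := by
  funext x
  have hd : DifferentiableAt ℝ (inChart x a) (extChartAt (𝓡 n) x x) := by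
    refine ((ha x).contDiffAt ?_).differentiableAt (by simp)
    simpa using extChartAt_target_mem_nhds (I := 𝓡 n) x
  rw [extD, inChart_smul, extDeriv, fderiv_fun_const_smul hd,
    ContinuousAlternatingMap.alternatizeUncurryFin_smul]
  rfl

theorem extD_zero {k : ℕ} : extD (0 : DiffForm n X k) = 0 := by
  simpa using extD_sum (∅ : Finset Empty) (a := fun _ => (0 : DiffForm n X k)) (by simp)

/-- The powers of a `2`-form. -/
def formPow (θ : DiffForm n X 2) (m : ℕ) : DiffForm n X (2 * m) := fun x => altPow (θ x) m

theorem matWedge_diagonal {p q : ℕ} {ι : Type*} [Fintype ι] [DecidableEq ι]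
    (a : ι → DiffForm n X p) (b : ι → DiffForm n X q) :
    matWedge (Matrix.diagonal a) (Matrix.diagonal b) =
      Matrix.diagonal fun i => wedge (a i) (b i) := by
  have h0 : ∀ b : DiffForm n X q, wedge (0 : DiffForm n X p) b = 0 := fun b =>
    funext fun x => wedgeAlt_zero_left (b x)
  have h1 : ∀ a : DiffForm n X p, wedge a (0 : DiffForm n X q) = 0 := fun a =>
    funext fun x => wedgeAlt_zero_right (a x)
  ext i k : 2
  rw [matWedge, Finset.sum_eq_single i]
  · rw [Matrix.diagonal_apply_eq]
    rcases eq_or_ne i k with rfl | hik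
    · simp
    · simp [hik, h1]
  · intro j _ hj
    rw [Matrix.diagonal_apply_ne' _ hj, h0]
  · simp

/-- The quadratic term is diagonal with entries `a_i ∧ a_i = 0`. -/
theorem curvature_diagonal {r : ℕ} (a : Fin r → DiffForm n X 1) :
    curvature (Matrix.diagonal a) = Matrix.diagonal fun i => extD (a i) := by
  have h : ∀ i, wedge (a i) (a i) = 0 := fun i => funext fun x => wedgeAlt_self_one (a i x)
  rw [curvature, matWedge_diagonal]
  simp only [h]
  have hz : Matrix.diagonal (fun _ : Fin r => (0 : DiffForm n X (1 + 1))) = 0 := by simp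
  rw [hz, add_zero]
  ext i k : 2
  rw [matD]
  rcases eq_or_ne i k with rfl | hik
  · simp
  · simp [hik, extD_zero]

theorem matPow_diagonal {r : ℕ} (θ : Fin r → DiffForm n X 2) (m : ℕ) :
    matPow (Matrix.diagonal θ) m = Matrix.diagonal fun i => formPow (θ i) m := by
  induction m with
  | zero =>
    ext i k : 2
    rw [matPow, matOfFun]
    rcases eq_or_ne i k with rfl | hik
    · simp only [Matrix.one_apply_eq, Matrix.diagonal_apply_eq]
      rfl
    · simp only [Matrix.one_apply_ne hik, Matrix.diagonal_apply_ne _ hik]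
      rfl
  | succ m ih =>
    rw [matPow, ih, matWedge_diagonal]
    rfl

/-- The Chern character of the trivial line bundle with connection `d + a`. -/
def chLine (a : DiffForm n X 1) : EvenForm n X := fun m =>
  ((m.factorial : ℂ)⁻¹ * (Complex.I / (2 * Real.pi)) ^ m) • formPow (extD a) m

theorem ch_trivialBundle_diagonal {r : ℕ} (a : Fin r → DiffForm n X 1)
    (hA : ∀ i j, IsSmooth (Matrix.diagonal a i j)) :
    (trivialBundle X r (Matrix.diagonal a) hA).ch = ∑ i, chLine (a i) := by
  have h : (trivialBundle X r (Matrix.diagonal a) hA).ch =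
      trExp (curvature (Matrix.diagonal a)) := rfl
  rw [h, curvature_diagonal]
  funext m
  rw [trExp, matPow_diagonal, Matrix.trace_diagonal, Finset.smul_sum, Finset.sum_apply]
  rfl

theorem ch_trivialBundle_zero (r : ℕ) :
    (trivialBundle X r (0 : Matrix (Fin r) (Fin r) (DiffForm n X 1))
      fun _ _ => isSmooth_zero).ch = ∑ _i : Fin r, chLine 0 := by
  rw [← ch_trivialBundle_diagonal (fun _ : Fin r => (0 : DiffForm n X 1))]
  · congr
    simp
  · intro i j
    simpa using isSmooth_zero

variable (n X) in
/-- The differences `ch (d + a) - ch d` on the trivial line bundle. -/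
def lineDifferences : Set (EvenForm n X) := {w | ∃ a, IsSmooth a ∧ w = chLine a - chLine 0}

/-- A sum of differences is realised by the direct sum of the line bundles, that is, by a diagonal
connection matrix. No negatives are available on a single trivial bundle, hence the submonoid and
not the subgroup. -/
theorem exists_connection_of_mem_closure {w : EvenForm n X}
    (hw : w ∈ AddSubmonoid.closure (lineDifferences n X)) :
    ∃ (r : ℕ) (A : Matrix (Fin r) (Fin r) (DiffForm n X 1)) (hA : ∀ i j, IsSmooth (A i j)),
      (trivialBundle X r A hA).ch - (trivialBundle X r 0 fun _ _ => isSmooth_zero).ch = w := by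
  obtain ⟨L, hL, rfl⟩ := AddSubmonoid.exists_list_of_mem_closure hw
  have h : ∀ i : Fin L.length, ∃ a, IsSmooth a ∧ L.get i = chLine a - chLine 0 := fun i =>
    hL _ (L.get_mem i)
  choose a ha hLa using h
  have hA : ∀ i j, IsSmooth (Matrix.diagonal a i j) := by
    intro i j
    rcases eq_or_ne i j with rfl | hij
    · simpa using ha i
    · simpa [hij] using isSmooth_zero
  refine ⟨L.length, Matrix.diagonal a, hA, ?_⟩
  rw [ch_trivialBundle_diagonal, ch_trivialBundle_zero, ← Finset.sum_sub_distrib]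
  simp only [← hLa]
  conv_rhs => rw [← List.ofFn_get L, List.sum_ofFn]

theorem chLine_sub_zero (a : DiffForm n X 1) : (chLine a - chLine 0 : EvenForm n X) 0 = 0 :=
  sub_self (chLine a 0)

theorem chLine_sub_succ (a : DiffForm n X 1) (m : ℕ) :
    (chLine a - chLine 0 : EvenForm n X) (m + 1) = chLine a (m + 1) := by
  have h : chLine (0 : DiffForm n X 1) (m + 1) = 0 := by
    have h0 : formPow (extD (0 : DiffForm n X 1)) (m + 1) = 0 := by
      funext x
      rw [extD_zero]
      exact wedgeAlt_zero_right _
    rw [chLine, h0]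
    funext x
    exact smul_zero (M := ℂ) (A := TangentSpace (𝓡 n) x [⋀^Fin (2 * (m + 1))]→L[ℝ] ℂ) _
  rw [Pi.sub_apply, h, sub_zero]

theorem diffForm_eq_zero {k : ℕ} (hk : n < k) (a : DiffForm n X k) : a = 0 := by
  funext x
  ext v
  refine (a x).toAlternatingMap.map_linearDependent v fun hv => ?_
  have h : Fintype.card (Fin k) ≤ Module.finrank ℝ (EuclideanSpace ℝ (Fin n)) :=
    LinearIndependent.fintype_card_le_finrank (M := EuclideanSpace ℝ (Fin n)) hv
  simp at h
  omega

/-! ### Isolating one degree with roots of unity -/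

variable [IsManifold (𝓡 n) ∞ X]

theorem isSmooth_and_extD_smul_sum {k : ℕ} {φ : Fin k → Fin 2 → X → ℂ}
    (hφ : ∀ i b, ContMDiff (𝓡 n) 𝓘(ℝ, ℂ) ∞ (φ i b)) (c : ℂ) :
    IsSmooth (c • ∑ i, monForm (n := n) (p := 1) (φ i 0) fun _ => φ i 1) ∧
      extD (c • ∑ i, monForm (n := n) (p := 1) (φ i 0) fun _ => φ i 1) =
        fun x => c • ∑ i, detForm fun b => dFun (φ i b) x := by
  have h1 : ∀ i ∈ Finset.univ, IsSmooth (monForm (n := n) (p := 1) (φ i 0) fun _ => φ i 1) :=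
    fun i _ => isSmooth_monForm (hφ i 0) fun _ => hφ i 1
  refine ⟨(isSmooth_sum _ h1).const_smul c, ?_⟩
  rw [extD_smul (isSmooth_sum _ h1), extD_sum _ h1]
  funext x
  rw [Pi.smul_apply, Finset.sum_apply]
  congr 1
  refine Finset.sum_congr rfl fun i _ => ?_
  rw [extD_monForm (hφ i 0) fun _ => hφ i 1]
  congr 1

theorem sum_primitiveRoot_pow {k m : ℕ} {z : ℂ} (hz : IsPrimitiveRoot z k) (hm : 0 < m)
    (hmk : m < k) : ∑ j ∈ Finset.range k, (z ^ j) ^ m = 0 := by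
  have h1 : z ^ m - 1 ≠ 0 := sub_ne_zero.2 (hz.pow_ne_one_of_pos_of_lt hm.ne' hmk)
  have h2 : (∑ j ∈ Finset.range k, (z ^ m) ^ j) * (z ^ m - 1) = 0 := by
    rw [geom_sum_mul, ← pow_mul, mul_comm, pow_mul, hz.pow_eq_one, one_pow, sub_self]
  have h3 : ∑ j ∈ Finset.range k, (z ^ j) ^ m = ∑ j ∈ Finset.range k, (z ^ m) ^ j :=
    Finset.sum_congr rfl fun j _ => by rw [← pow_mul, ← pow_mul, mul_comm]
  rw [h3]
  exact (mul_eq_zero.1 h2).resolve_right h1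

/-- Average over the connections `d + z^j s ∑ φ_(i,0) dφ_(i,1)`, `j < k`. Below degree `2k` the
root-of-unity sums vanish, and above it the powers of the curvature vanish. -/
theorem single_mem_closure {k : ℕ} (hk : 0 < k) {φ : Fin k → Fin 2 → X → ℂ}
    (hφ : ∀ i b, ContMDiff (𝓡 n) 𝓘(ℝ, ℂ) ∞ (φ i b)) :
    (Pi.single k (fun x => detForm fun l => dFun (pairs φ id l) x) : EvenForm n X) ∈
      AddSubmonoid.closure (lineDifferences n X) := by
  have hpi : (Complex.I / (2 * Real.pi)) ^ k ≠ 0 := by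
    refine pow_ne_zero _ (div_ne_zero Complex.I_ne_zero ?_)
    exact_mod_cast mul_ne_zero two_ne_zero Real.pi_ne_zero
  have hk' : (k : ℂ) ≠ 0 := by exact_mod_cast hk.ne'
  -- In degree `2k` the `k` roots contribute the factor `k s^k (i/2π)^k`, while `1/k!` cancels the
  -- `k!` of `altPow_self`; `s` makes this factor 1. A complex root always exists, so signs and
  -- scalars cost nothing.
  obtain ⟨s, hs⟩ := IsAlgClosed.exists_pow_nat_eq
    ((k * (Complex.I / (2 * Real.pi)) ^ k)⁻¹ : ℂ) hk
  have hz := Complex.isPrimitiveRoot_exp k hk.ne'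
  set z := Complex.exp (2 * Real.pi * Complex.I / k)
  let a : ℕ → DiffForm n X 1 := fun j =>
    (z ^ j * s) • ∑ i, monForm (n := n) (p := 1) (φ i 0) fun _ => φ i 1
  have ha : ∀ j, extD (a j) = fun x => (z ^ j * s) • ∑ i, detForm fun b => dFun (φ i b) x :=
    fun j => (isSmooth_and_extD_smul_sum hφ _).2
  have hsum : (Pi.single k (fun x => detForm fun l => dFun (pairs φ id l) x) : EvenForm n X) =
      ∑ j ∈ Finset.range k, (chLine (a j) - chLine 0) := by
    funext m
    rw [Finset.sum_apply]
    rcases m with _ | m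
    · rw [Pi.single_eq_of_ne hk.ne, Finset.sum_eq_zero]
      exact fun j _ => chLine_sub_zero (a j)
    simp only [chLine_sub_succ, chLine, ha]
    funext x
    rw [Finset.sum_apply]
    let u : Fin k → Fin 2 → TangentSpace (𝓡 n) x →L[ℝ] ℂ := fun i b => dFun (φ i b) x
    have hL : ∀ j, (((m + 1).factorial : ℂ)⁻¹ * (Complex.I / (2 * Real.pi)) ^ (m + 1)) •
        formPow (fun x => (z ^ j * s) • ∑ i, detForm fun b => dFun (n := n) (φ i b) x) (m + 1) x =
        (((m + 1).factorial : ℂ)⁻¹ * (Complex.I / (2 * Real.pi)) ^ (m + 1)) •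
          altPow ((z ^ j * s) • ∑ i, detForm (u i)) (m + 1) := fun j => rfl
    refine Eq.trans ?_ (Finset.sum_congr rfl fun j _ => (hL j).symm)
    rcases lt_trichotomy (m + 1) k with h | h | h
    · rw [Pi.single_eq_of_ne h.ne, ← Finset.smul_sum]
      simp only [altPow_smul_sum, mul_pow]
      rw [← Finset.sum_smul, ← Finset.sum_mul, sum_primitiveRoot_pow hz m.succ_pos h, zero_mul,
        zero_smul, smul_zero]
      rfl
    · subst h
      rw [Pi.single_eq_same]
      simp only [altPow_self, mul_pow, hs]
      have hz1 : ∀ j, (z ^ j) ^ (m + 1) = 1 := fun j => by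
        rw [← pow_mul, mul_comm, pow_mul, hz.pow_eq_one, one_pow]
      have hf : ((m + 1).factorial : ℂ) ≠ 0 := by exact_mod_cast (m + 1).factorial_ne_zero
      simp only [hz1, one_mul, smul_smul]
      rw [← Finset.sum_smul, Finset.sum_const, Finset.card_range, nsmul_eq_mul]
      have hone : ((m + 1 : ℕ) : ℂ) * (((m + 1).factorial : ℂ)⁻¹ *
          (Complex.I / (2 * Real.pi)) ^ (m + 1) * ((((m + 1 : ℕ) : ℂ) *
            (Complex.I / (2 * Real.pi)) ^ (m + 1))⁻¹ * (m + 1).factorial)) = 1 := by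
        field_simp
      rw [hone, one_smul]
      congr 1
    · rw [Pi.single_eq_of_ne h.ne', Finset.sum_eq_zero]
      · rfl
      · intro j _
        rw [altPow_of_lt _ _ h]
        exact smul_zero (M := ℂ) (A := TangentSpace (𝓡 n) x [⋀^Fin (2 * (m + 1))]→L[ℝ] ℂ) _
  rw [hsum]
  exact AddSubmonoid.sum_mem _ fun j _ =>
    AddSubmonoid.subset_closure ⟨a j, (isSmooth_and_extD_smul_sum hφ _).1, rfl⟩

theorem single_extD_mem_closure [T2Space X] [SecondCountableTopology X] {m : ℕ}
    {α : DiffForm n X (2 * m + 1)} (hα : IsSmooth α) :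
    (Pi.single (m + 1) (extD α) : EvenForm n X) ∈ AddSubmonoid.closure (lineDifferences n X) := by
  obtain ⟨N, φ, g, hφ, hg, rfl⟩ := exists_eq_sum_monForm hα
  rw [extD_sum _ fun I _ => isSmooth_monForm (hφ I) (hg I)]
  have hmap := map_sum (AddMonoidHom.single (fun m => DiffForm n X (2 * m)) (m + 1))
    (fun I => extD (monForm (n := n) (φ I) (g I))) Finset.univ
  refine (congrArg (· ∈ AddSubmonoid.closure (lineDifferences n X)) hmap).mpr ?_
  refine AddSubmonoid.sum_mem _ fun I _ => ?_
  -- The coefficient joins the `2m + 1` functions as the first factor, `d(φ dg_1 ∧ …) = dφ ∧ dg_1 ∧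
  -- …`, and the resulting `2(m + 1)` functions are grouped in consecutive pairs.
  let ψ : Fin (2 * (m + 1)) → X → ℂ := Fin.cons (α := fun _ => X → ℂ) (φ I) (g I)
  have hψ : ∀ l, ContMDiff (𝓡 n) 𝓘(ℝ, ℂ) ∞ (ψ l) := Fin.cases (hφ I) (hg I)
  have h := single_mem_closure (n := n) m.succ_pos
    (φ := fun (i : Fin (m + 1)) (b : Fin 2) => ψ ⟨2 * i + b, by omega⟩) fun i b => hψ _
  have hp : pairs (fun (i : Fin (m + 1)) (b : Fin 2) => ψ ⟨2 * i + b, by omega⟩) id = ψ := by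
    funext l
    have : 2 * (l.1 / 2) + l.1 % 2 = l := by omega
    simp [pairs, this]
  rw [hp] at h
  rw [extD_monForm (hφ I) (hg I)]
  exact h

theorem mem_closure_of_isExactEven [T2Space X] [SecondCountableTopology X] {w : EvenForm n X}
    (hw : IsExactEven w) : w ∈ AddSubmonoid.closure (lineDifferences n X) := by
  obtain ⟨α, hα, rfl⟩ := hw
  -- The family `α` has infinitely many components, but for `m ≥ n` the degree `2(m + 1)` exceeds
  -- `n` and the form is zero.
  have h : extDOdd α = ∑ m ∈ Finset.range n, (Pi.single (m + 1) (extD (α m)) : EvenForm n X) := by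
    funext k
    rw [Finset.sum_apply]
    rcases k with _ | k
    · rw [Finset.sum_eq_zero fun m _ => Pi.single_eq_of_ne m.succ_ne_zero.symm _]
      rfl
    · by_cases hk : k < n
      · rw [Finset.sum_eq_single_of_mem k (Finset.mem_range.2 hk) fun m _ hm =>
          Pi.single_eq_of_ne (by omega) _, Pi.single_eq_same]
        rfl
      · rw [diffForm_eq_zero (by omega) (extDOdd α (k + 1)), Finset.sum_eq_zero]
        exact fun m _ => diffForm_eq_zero (by omega) _
  rw [h]
  exact AddSubmonoid.sum_mem _ fun m _ => single_extD_mem_closure (hα m)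

end

end ChernForms

end

theorem mainTheorem5 (n : ℕ) (X : Type*) [TopologicalSpace X] [T2Space X]
    [SecondCountableTopology X] [ChartedSpace (EuclideanSpace ℝ (Fin n)) X]
    [IsManifold (𝓡 n) ∞ X] :
    (∀ w : ChernForms.EvenForm n X, ChernForms.IsExactEven w →
      w ∈ (ChernForms.chHom (n := n) (X := X)).range) ∧
    (∀ w : ChernForms.EvenForm n X, ChernForms.IsExactEven w →
      ∃ (r : ℕ) (A : Matrix (Fin r) (Fin r) (ChernForms.DiffForm n X 1))
        (hA : ∀ i j, ChernForms.IsSmooth (A i j)),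
        (ChernForms.trivialBundle X r A hA).ch
          - (ChernForms.trivialBundle X r 0 fun _ _ => ChernForms.isSmooth_zero).ch = w) := by
  refine ⟨fun w hw => ?_, fun w hw =>
    ChernForms.exists_connection_of_mem_closure (ChernForms.mem_closure_of_isExactEven hw)⟩
  obtain ⟨r, A, hA, rfl⟩ :=
    ChernForms.exists_connection_of_mem_closure (ChernForms.mem_closure_of_isExactEven hw)
  refine ⟨FreeAbelianGroup.of (ChernForms.trivialBundle X r A hA) -
    FreeAbelianGroup.of (ChernForms.trivialBundle X r 0 fun _ _ => ChernForms.isSmooth_zero), ?_⟩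
  rw [map_sub, ChernForms.chHom, FreeAbelianGroup.lift_apply_of, FreeAbelianGroup.lift_apply_of]
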